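/- Let $(X,\mu)$ be a standard probability space and let $\mathcal G$ be a Borel graph on $X$ (a simple undirected graph whose edge relation is a Borel subset of $X^2$), with connectedness relation $E_{\mathcal G}$ (the equivalence relation whose classes are the connected components). Assume that $\mathcal G$ is pmp (every partial Borel injection whose graph is contained in $E_{\mathcal G}$ preserves $\mu$), ergodic (every $E_{\mathcal G}$-invariant Borel set has measure $0$ or $1$), and $d$-regular for some $d\in\mathbb N$ (after discarding a null set, every vertex has exactly $d$ neighbors). Let $L$ be the Laplacian on the complex Hilbert space $L^2(X,\mu)$, $(Lf)(x)=\deg(x)f(x)-\sum_{y\sim x}f(y)$, let $L^2_0(X)=L^2(X)\ominus\mathbb C1$, and put $$m_L=\inf_{0\ne f\in L^2_0(X)}\frac{\langle Lf,f\rangle}{\langle f,f\rangle},\qquad M_L=\sup_{0\ne f\in L^2_0(X)}\frac{\langle Lf,f\rangle}{\langle f,f\rangle}.$$ For a $\mu$-measurable set $A\subseteq X$ let $\mathcal O_A$ be the set of points of $X\setminus A$ that lie in a finite component with an odd number of vertices of the induced graph $\mathcal G\restriction(X\setminus A)$, let $\mathcal O_A^{(2k+1)}\subseteq\mathcal O_A$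 be the set of those points whose component has exactly $2k+1$ vertices, and let $$\nu_A(Y)=\sum_{k\ge 0}\frac{1}{2k+1}\,\mu\big(Y\cap\mathcal O_A^{(2k+1)}\big)\qquad(Y\subseteq\mathcal O_A).$$ Suppose that $2m_L\ge M_L$. (1) If $\mu$ is nonatomic, then $\mathcal G$ satisfies the strict measurable Tutte condition: there is a constant $c<1$ such that $\nu_A(\mathcal O_A)\le c\,\mu(A)$ for every $\mu$-measurable set $A\subseteq X$. (2) If $\mu$ has an atom (in which case $\mathcal G$ is, up to a null set, a finite connected graph with the uniform measure) and the number of atoms is even, then $\mathcal G$ satisfies Tutte's condition: $\nu_A(\mathcal O_A)\le\mu(A)$ for every $\mu$-measurable set $A\subseteq X$. -/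

import Mathlib

open MeasureTheory
open scoped ENNReal NNReal ComplexConjugate

noncomputable section

namespace BorelGraph

/-- The edge relation of the (simple, undirected) graph `G` is a Borel subset of `X × X`. -/
def IsBorel {X : Type*} [MeasurableSpace X] (G : SimpleGraph X) : Prop :=
  MeasurableSet {p : X × X | G.Adj p.1 p.2}

/-- `G` is `μ`-probability measure preserving: every Borel injection `θ` with Borel domain `D`
whose graph is contained in the connectedness relation of `G` preserves `μ`. (A Borel map on `D`
is the same as the restriction to `D` of a Borel map on `X`; images of Borel sets under
Borel injections are Borel.) -/
def IsPMP {X : Type*} [MeasurableSpace X] (G : SimpleGraph X) (μ : Measure X) : Prop :=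
  ∀ (D : Set X) (θ : X → X), MeasurableSet D → Measurable θ → Set.InjOn θ D →
    (∀ x ∈ D, G.Reachable x (θ x)) →
      ∀ A : Set X, MeasurableSet A → A ⊆ D → μ (θ '' A) = μ A

/-- `G` is ergodic: Borel sets that are invariant under the connectedness relation of `G` are
null or conull. -/
def IsErgodic {X : Type*} [MeasurableSpace X] (G : SimpleGraph X) (μ : Measure X) : Prop :=
  ∀ A : Set X, MeasurableSet A → (∀ x y, G.Reachable x y → x ∈ A → y ∈ A) → μ A = 0 ∨ μ A = 1

/-- `G` is `d`-regular up to a null set: for almost every `x`, each vertex in the connected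
component of `x` has exactly `d` neighbors. In particular this holds if every vertex of `G` has
exactly `d` neighbors. -/
def IsRegular {X : Type*} [MeasurableSpace X] (G : SimpleGraph X) (μ : Measure X) (d : ℕ) : Prop :=
  ∀ᵐ x ∂μ, ∀ y, G.Reachable x y → (G.neighborSet y).encard = d

/-- The Laplacian, `(L f)(x) = deg(x) f(x) - ∑_{y ∼ x} f(y)`. -/
def laplacian {X : Type*} (G : SimpleGraph X) (f : X → ℂ) (x : X) : ℂ :=
  ((G.neighborSet x).ncard : ℂ) * f x - ∑ᶠ y ∈ G.neighborSet x, f y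

/-- `L²₀(X)`, the orthogonal complement of the constant functions in the complex Hilbert space
`L²(X, μ)`. -/
def L20 {X : Type*} [MeasurableSpace X] (μ : Measure X) [IsFiniteMeasure μ] :
    Submodule ℂ (Lp ℂ 2 μ) :=
  (Submodule.span ℂ {Lp.const 2 μ (1 : ℂ)})ᗮ

/-- The Rayleigh quotient `⟨L f, f⟩ / ⟨f, f⟩`, where `⟨g, h⟩ = ∫ g(x) conj(h(x)) dμ(x)`. (For a
pmp graph of bounded degree, `L` is a well-defined bounded self-adjoint operator on `L²(X, μ)`,
so the integrand below is integrable and the integral in the numerator is real.) -/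
def rayleigh {X : Type*} [MeasurableSpace X] (G : SimpleGraph X) (μ : Measure X) (f : Lp ℂ 2 μ) :
    ℝ :=
  (∫ x, laplacian G f x * conj (f x) ∂μ).re / ‖f‖ ^ 2

/-- `m_L`, the infimum of the Rayleigh quotient over nonzero `f ∈ L²₀(X)`. The infimum is taken in
the extended reals, so that no convention about unbounded or empty sets of reals enters. -/
def mL {X : Type*} [MeasurableSpace X] (G : SimpleGraph X) (μ : Measure X) [IsFiniteMeasure μ] :
    EReal :=
  ⨅ f : {f : Lp ℂ 2 μ // f ∈ L20 μ ∧ f ≠ 0}, ((rayleigh G μ f.1 : ℝ) : EReal)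

/-- `M_L`, the supremum of the Rayleigh quotient over nonzero `f ∈ L²₀(X)`. -/
def ML {X : Type*} [MeasurableSpace X] (G : SimpleGraph X) (μ : Measure X) [IsFiniteMeasure μ] :
    EReal :=
  ⨆ f : {f : Lp ℂ 2 μ // f ∈ L20 μ ∧ f ≠ 0}, ((rayleigh G μ f.1 : ℝ) : EReal)

/-- The vertex set of the connected component of `x ∉ A` in the induced graph `G ↾ (X ∖ A)`. -/
def componentOff {X : Type*} (G : SimpleGraph X) (A : Set X) (x : ↥(Aᶜ)) : Set ↥(Aᶜ) :=
  ((G.induce Aᶜ).connectedComponentMk x).supp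

/-- `O_A`, the set of points of `X ∖ A` that lie in a finite odd component of `G ↾ (X ∖ A)`. -/
def oddSet {X : Type*} (G : SimpleGraph X) (A : Set X) : Set X :=
  {x | ∃ hx : x ∈ Aᶜ, (componentOff G A ⟨x, hx⟩).Finite ∧ Odd (componentOff G A ⟨x, hx⟩).ncard}

/-- The set of points of `X ∖ A` that lie in a component of `G ↾ (X ∖ A)` with exactly `n`
vertices. -/
def sizeSet {X : Type*} (G : SimpleGraph X) (A : Set X) (n : ℕ) : Set X :=
  {x | ∃ hx : x ∈ Aᶜ, (componentOff G A ⟨x, hx⟩).encard = n}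

/-- `ν_A(Y) = ∑_{k ≥ 0} μ(Y ∩ O_A^{(2k+1)}) / (2k+1)`, where `O_A^{(2k+1)}` is the set of points in
components of `G ↾ (X ∖ A)` of size `2k+1`. -/
def nu {X : Type*} [MeasurableSpace X] (G : SimpleGraph X) (μ : Measure X) (A Y : Set X) : ℝ≥0∞ :=
  ∑' k : ℕ, μ (Y ∩ sizeSet G A (2 * k + 1)) / ((2 * k + 1 : ℕ) : ℝ≥0∞)

/-- The measurable Tutte condition with constant `c`: `ν_A(O_A) ≤ c μ(A)` for all `μ`-measurable
sets `A`. -/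
def TutteCondition {X : Type*} [MeasurableSpace X] (G : SimpleGraph X) (μ : Measure X)
    (c : ℝ≥0) : Prop :=
  ∀ A : Set X, NullMeasurableSet A μ → nu G μ A (oddSet G A) ≤ (c : ℝ≥0∞) * μ A

/-- The strict measurable Tutte condition: the condition above holds for some `c < 1`. -/
def StrictTutteCondition {X : Type*} [MeasurableSpace X] (G : SimpleGraph X)
    (μ : Measure X) : Prop :=
  ∃ c : ℝ≥0, c < 1 ∧ TutteCondition G μ c

end BorelGraph

end

/-! Write e(S,T) for the measure of the set of edges from S to T. Since the graph is pmp, e is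
symmetric and e(X,A) = dμ(A). For disjoint S and T the centered function 1_S - 1_T - c has energy
e(S,Sᶜ) + e(T,Tᶜ) + 2e(S,T) and squared norm μ(S) + μ(T) - (μ(S) - μ(T))². The hypothesis `ML ≤ 2 *
mL` compares any two such functions, so each good choice of one function becomes an inequality for
all the others (`spectral_le`).

Nonatomic case. An independent set of positive measure shows M_L ≥ d, hence m_L ≥ d/2 and e(P,Pᶜ) ≥
(d/2)μ(P)(1 - μ(P)). A union S of components of size n splits into arbitrarily small unions of
components, and its outgoing edges all end in A, so the factor 1 - μ(P) disappears: e(S,A) ≥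
(d/2)μ(S). Components of size at least 3 therefore send at least 3d/2 edges each to A, on average.
Isolated points send only d, which gives the constant 1 and no better. For them, arbitrarily small
sets in which every point has a neighbor show m_L ≤ d - 1, hence M_L ≤ 2(d - 1). Applied to 1_I -
1_A with I the set of isolated points, this yields (d+1)μ(I) ≤ (d-1)μ(A). Together the two bounds
give c = 1 - 2/(3(d+1)).

Atomic case. The graph is finite and connected with n vertices. The function 1_x - 1_y for an edge
xy shows M_L ≥ d + 1, hence m_L ≥ (d+1)/2. It follows that every component with at most n/2 vertices
sends at least d edges to A. At most one component is larger, and A receives at most d|A| edges, so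
there are at most |A| + 1 odd components. As n is even, parity excludes equality. -/

noncomputable section

namespace BorelGraph

/-! ### Borel enumeration of the neighbors -/

/-- A set of `d` elements is listed in increasing order of an injective real function. -/
theorem exists_sorted_enumeration {X : Type*} {φ : X → ℝ} (hφ : Function.Injective φ) {N : Set X}
    {d : ℕ} (hN : N.encard = d) : ∃ y : Fin d → X, StrictMono (φ ∘ y) ∧ Set.range y = N := by
  classical
  have hfin : N.Finite := Set.finite_of_encard_eq_coe hN
  lift N to Finset X using hfin
  have hcard : N.card = d := by simpa using hN
  have hc : (N.image φ).card = d := by rw [Finset.card_image_of_injective _ hφ, hcard]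
  have hmem : ∀ i, ∃ x ∈ N, φ x = (N.image φ).orderEmbOfFin hc i := fun i => by
    exact Finset.mem_image.1 (Finset.orderEmbOfFin_mem (N.image φ) hc i)
  choose y hyN hy using hmem
  have hmono : StrictMono (φ ∘ y) := fun i j hij => by
    simpa [hy] using hij
  refine ⟨y, hmono, ?_⟩
  have hinj : Function.Injective y := hmono.injective.of_comp
  have : Finset.univ.image y = N := by
    apply Finset.eq_of_subset_of_card_le
    · intro x hx
      obtain ⟨i, -, rfl⟩ := Finset.mem_image.1 hx
      exact hyN i
    · rw [Finset.card_image_of_injective _ hinj]; simp [hcard]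
  rw [← this]; simp

theorem sorted_enumeration_unique {X : Type*} {φ : X → ℝ} (hφ : Function.Injective φ) {d : ℕ}
    {y z : Fin d → X} (hy : StrictMono (φ ∘ y)) (hz : StrictMono (φ ∘ z))
    (h : Set.range y = Set.range z) : y = z := by
  have : φ ∘ y = φ ∘ z := by
    rw [← hy.range_inj hz, Set.range_comp, Set.range_comp, h]
  exact funext fun i => hφ (congrFun this i)

theorem range_eq_of_card {X : Type*} {d : ℕ} {y : Fin d → X} (hy : Function.Injective y)
    {N : Set X} (hN : N.encard = d) (h : ∀ i, y i ∈ N) : Set.range y = N := by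
  refine (Set.finite_of_encard_eq_coe hN).eq_of_subset_of_encard_le' (Set.range_subset_iff.2 h) ?_
  rw [hN, ← Set.image_univ, hy.encard_image]; simp

open Classical in
/-- The neighbors of a vertex of degree `d`, in increasing order of `φ`. -/
def nbr {X : Type*} (φ : X → ℝ) (G : SimpleGraph X) (d : ℕ) (x : X) : Fin d → X :=
  if h : ∃ y : Fin d → X, StrictMono (φ ∘ y) ∧ Set.range y = G.neighborSet x then h.choose
  else fun _ => x

theorem nbr_spec {X : Type*} {φ : X → ℝ} (hφ : Function.Injective φ) {G : SimpleGraph X} {d : ℕ}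
    {x : X} (hx : (G.neighborSet x).encard = d) :
    StrictMono (φ ∘ nbr φ G d x) ∧ Set.range (nbr φ G d x) = G.neighborSet x := by
  have h := exists_sorted_enumeration hφ hx
  rw [nbr, dif_pos h]
  exact h.choose_spec

theorem nbr_unique {X : Type*} {φ : X → ℝ} (hφ : Function.Injective φ) {G : SimpleGraph X} {d : ℕ}
    {x : X} (hx : (G.neighborSet x).encard = d) {y : Fin d → X} (hy : StrictMono (φ ∘ y))
    (hadj : ∀ i, G.Adj x (y i)) : y = nbr φ G d x := by
  have h := nbr_spec hφ hx
  refine sorted_enumeration_unique hφ hy h.1 ?_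
  rw [h.2]
  exact range_eq_of_card hy.injective.of_comp hx hadj

/-- By Lusin–Souslin: the preimage of a Borel set is an injective projection of a Borel set, because
the increasing list of neighbors is unique. The inner map `f` allows iteration along words, whose
values may leave the Borel set of starting points. -/
theorem measurable_nbr_comp {X Z : Type*} [MeasurableSpace X] [StandardBorelSpace X]
    [MeasurableSpace Z] [StandardBorelSpace Z] {φ : X → ℝ} (hφ : Function.Injective φ)
    (hφm : Measurable φ) {G : SimpleGraph X} (hG : IsBorel G) {d : ℕ} {f : Z → X}
    (hf : Measurable f) (hdeg : ∀ z, (G.neighborSet (f z)).encard = d) :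
    Measurable fun z => nbr φ G d (f z) := by
  set W : Set (Z × (Fin d → X)) :=
    {p | StrictMono (φ ∘ p.2) ∧ ∀ i, G.Adj (f p.1) (p.2 i)} with hW
  have hWm : MeasurableSet W := by
    have h1 : W = (⋂ i, ⋂ j, ⋂ _ : i < j, {p : Z × (Fin d → X) | φ (p.2 i) < φ (p.2 j)}) ∩
        ⋂ i, (fun p : Z × (Fin d → X) => (f p.1, p.2 i)) ⁻¹' {q | G.Adj q.1 q.2} := by
      ext p
      simp [hW, StrictMono]
    rw [h1]
    refine MeasurableSet.inter ?_ (MeasurableSet.iInter fun i => ?_)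
    · refine MeasurableSet.iInter fun i => MeasurableSet.iInter fun j =>
        MeasurableSet.iInter fun _ => measurableSet_lt ?_ ?_ <;> fun_prop
    · exact (by fun_prop : Measurable fun p : Z × (Fin d → X) => (f p.1, p.2 i)) hG
  intro U hU
  have : (fun z => nbr φ G d (f z)) ⁻¹' U = Prod.fst '' (W ∩ Prod.snd ⁻¹' U) := by
    ext z
    constructor
    · intro hz
      have h := nbr_spec hφ (hdeg z)
      refine ⟨(z, nbr φ G d (f z)), ⟨⟨h.1, fun i => ?_⟩, hz⟩, rfl⟩
      have : nbr φ G d (f z) i ∈ G.neighborSet (f z) := h.2 ▸ Set.mem_range_self i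
      exact this
    · rintro ⟨⟨z', y⟩, ⟨⟨h1, h2⟩, h3⟩, rfl⟩
      have := nbr_unique hφ (hdeg z') h1 h2
      simpa [← this] using h3
  rw [this]
  refine (hWm.inter (measurable_snd hU)).image_of_measurable_injOn measurable_fst ?_
  rintro ⟨z, y⟩ ⟨⟨h1, h2⟩, -⟩ ⟨z', y'⟩ ⟨⟨h1', h2'⟩, -⟩ (rfl : z = z')
  exact congrArg _ ((nbr_unique hφ (hdeg z) h1 h2).trans (nbr_unique hφ (hdeg z) h1' h2').symm)

theorem measurable_ite_mem {X : Type*} [MeasurableSpace X] {B : Set X} [DecidablePred (· ∈ B)]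
    (hB : MeasurableSet B)
    {f : X → X} (hf : Measurable fun x : ↥B => f x) :
    Measurable fun x => if x ∈ B then f x else x := by
  refine measurable_of_restrict_of_restrict_compl hB ?_ ?_
  · have : B.domRestrict (fun x => if x ∈ B then f x else x) = fun x : ↥B => f x :=
      funext fun x => if_pos x.2
    rwa [this]
  · have : Bᶜ.domRestrict (fun x => if x ∈ B then f x else x) = fun x : ↥(Bᶜ) => (x : X) :=
      funext fun x => if_neg x.2
    rw [this]
    exact measurable_subtype_coe

/-- Iterated maps `s i` along a word. -/
def along {X : Type*} {d : ℕ} (s : Fin d → X → X) : List (Fin d) → X → X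
  | [], x => x
  | i :: w, x => s i (along s w x)

theorem along_append {X : Type*} {d : ℕ} (s : Fin d → X → X) (v w : List (Fin d)) (x : X) :
    along s (v ++ w) x = along s v (along s w x) := by
  induction v with
  | nil => rfl
  | cons i v ih => simp [along, ih]

/-- Borel maps `s i` which, on the conull invariant Borel set `B`, list the neighbors of every
vertex without repetition. -/
structure Enumerates {X : Type*} [MeasurableSpace X] (G : SimpleGraph X) (μ : Measure X) {d : ℕ}
    (B : Set X) (s : Fin d → X → X) : Prop where
  measurableSet : MeasurableSet B
  measure_compl : μ Bᶜ = 0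
  measurable : ∀ i, Measurable (s i)
  mapsTo : ∀ i, ∀ x ∈ B, s i x ∈ B
  injective : ∀ x ∈ B, Function.Injective fun i => s i x
  range : ∀ x ∈ B, ∀ y, G.Adj x y ↔ ∃ i, s i x = y

theorem reachable_of_along {X : Type*} {G : SimpleGraph X} {d : ℕ} {s : Fin d → X → X} {R : Set X}
    (hR : ∀ x ∈ R, ∀ y, G.Reachable x y → y ∈ R)
    (hs : ∀ x ∈ R, ∀ i, G.Adj x (s i x)) {x : X} (hx : x ∈ R) (w : List (Fin d)) :
    G.Reachable x (along s w x) := by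
  induction w with
  | nil => exact SimpleGraph.Reachable.refl _
  | cons i w ih => exact ih.trans (hs _ (hR x hx _ ih) i).reachable

theorem exists_along_of_reachable {X : Type*} {G : SimpleGraph X} {d : ℕ} {s : Fin d → X → X}
    {R : Set X} (hR : ∀ x ∈ R, ∀ y, G.Reachable x y → y ∈ R)
    (hs : ∀ x ∈ R, ∀ y, G.Adj x y → ∃ i, s i x = y) {x y : X} (hx : x ∈ R)
    (h : G.Reachable x y) : ∃ w, along s w x = y := by
  obtain ⟨p⟩ := h
  have key : ∀ {a b : X} (p : G.Walk a b), a ∈ R → ∃ w, along s w a = b := by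
    intro a b p
    induction p with
    | nil => exact fun _ => ⟨[], rfl⟩
    | cons hadj p ih =>
      intro ha
      obtain ⟨i, rfl⟩ := hs _ ha _ hadj
      obtain ⟨w, hw⟩ := ih (hR _ ha _ hadj.reachable)
      exact ⟨w ++ [i], by rw [along_append]; exact hw⟩
  exact key p hx

/-- All later measure theory runs through Borel maps `s i`. The difficulty is to find a set that is
at once Borel, conull and invariant; invariance comes from deleting every point from which some word
leads into a null set. -/
theorem exists_enumerates {X : Type*} [MeasurableSpace X] [StandardBorelSpace X] {μ : Measure X}
    {G : SimpleGraph X} {d : ℕ} (hG : IsBorel G) (hpmp : IsPMP G μ) (hreg : IsRegular G μ d) :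
    ∃ (B : Set X) (s : Fin d → X → X), Enumerates G μ B s := by
  classical
  obtain ⟨φ, hφe⟩ := exists_measurableEmbedding_real X
  have hφ := hφe.injective
  have hφm := hφe.measurable
  set R : Set X := {x | ∀ y, G.Reachable x y → (G.neighborSet y).encard = d} with hRdef
  have hR : ∀ x ∈ R, ∀ y, G.Reachable x y → y ∈ R := fun x hx y hxy z hyz => hx z (hxy.trans hyz)
  have hdeg : ∀ x ∈ R, (G.neighborSet x).encard = d := fun x hx =>
    hx x (SimpleGraph.Reachable.refl _)
  -- `R` is invariant but need not be Borel; `Nᶜ` is Borel but need not be invariant.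
  obtain ⟨N, hRN, hNm, hN0⟩ := exists_measurable_superset_of_null (show μ Rᶜ = 0 from hreg)
  set t : Fin d → X → X := fun i x => nbr φ G d x i with ht
  have hadj : ∀ x ∈ R, ∀ y, G.Adj x y ↔ ∃ i, t i x = y := fun x hx y => by
    rw [← SimpleGraph.mem_neighborSet, ← (nbr_spec hφ (hdeg x hx)).2]; rfl
  have hadj1 : ∀ x ∈ R, ∀ i, G.Adj x (t i x) := fun x hx i => (hadj x hx _).2 ⟨i, rfl⟩
  have hBR : ∀ x ∈ Nᶜ, x ∈ R := fun x hx => by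
    by_contra h
    exact hx (hRN h)
  have hreach : ∀ x ∈ R, ∀ w, G.Reachable x (along t w x) := fun x hx w =>
    reachable_of_along hR hadj1 hx w
  have : StandardBorelSpace ↥(Nᶜ) := hNm.compl.standardBorel
  have hmeas : ∀ w, Measurable fun x : ↥(Nᶜ) => along t w x := by
    intro w
    induction w with
    | nil => exact measurable_subtype_coe
    | cons i w ih =>
      exact (measurable_pi_apply i).comp (measurable_nbr_comp hφ hφm hG ih
        fun z => hBR z z.2 _ (hreach z (hBR z z.2) w))
  have hpre : ∀ w (U : Set X), MeasurableSet U → MeasurableSet {x | x ∈ Nᶜ ∧ along t w x ∈ U} := by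
    intro w U hU
    have := hNm.compl.subtype_image (hmeas w hU)
    convert this using 1
    ext x
    simp [and_comm]
  have hnull : ∀ w, μ {x | x ∈ Nᶜ ∧ along t w x ∈ N} = 0 := by
    intro w
    -- Split according to a word `v` that leads back to `x`: where `v` inverts `w`, the map `along t
    -- w` is injective, so the pmp hypothesis applies to it and its image lies in the null set `N`.
    have hcov : {x | x ∈ Nᶜ ∧ along t w x ∈ N} ⊆
        ⋃ v, {x | x ∈ Nᶜ ∧ along t w x ∈ N ∧ along t (v ++ w) x = x} := by
      rintro x ⟨hx, hxw⟩
      have h1 := hreach x (hBR x hx) w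
      obtain ⟨v, hv⟩ := exists_along_of_reachable hR (fun x hx y => (hadj x hx y).1)
        (hR x (hBR x hx) _ h1) h1.symm
      exact Set.mem_iUnion.2 ⟨v, hx, hxw, by rw [along_append]; exact hv⟩
    refine measure_mono_null hcov (measure_iUnion_null fun v => ?_)
    set D : Set X := {x | x ∈ Nᶜ ∧ along t w x ∈ N ∧ along t (v ++ w) x = x} with hD
    have hDm : MeasurableSet D := by
      have h2 : MeasurableSet {x : ↥(Nᶜ) | along t (v ++ w) x = x} :=
        measurableSet_eq_fun (hmeas _) measurable_subtype_coe
      have := (hpre w N hNm).inter (hNm.compl.subtype_image h2)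
      convert this using 1
      ext x
      simp only [hD, Set.mem_ofPred_eq, Set.mem_inter_iff, Set.mem_image, Subtype.exists,
        exists_and_right, exists_eq_right, exists_prop]
      tauto
    have hθm : Measurable fun x => if x ∈ Nᶜ then along t w x else x :=
      measurable_ite_mem hNm.compl (hmeas w)
    have himg := hpmp D (fun x => if x ∈ Nᶜ then along t w x else x) hDm hθm ?_ ?_ D hDm
      subset_rfl
    · rw [← himg]
      refine measure_mono_null ?_ hN0
      rintro _ ⟨x, hx, rfl⟩
      simp only [if_pos hx.1]
      exact hx.2.1
    · intro x hx y hy hxy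
      simp only [if_pos hx.1, if_pos hy.1] at hxy
      rw [← hx.2.2, ← hy.2.2, along_append, along_append, hxy]
    · intro x hx
      simp only [if_pos hx.1]
      exact hreach x (hBR x hx.1) w
  set B : Set X := ⋂ w, {x | x ∈ Nᶜ ∧ along t w x ∈ Nᶜ} with hB
  have hBN : ∀ x ∈ B, x ∈ Nᶜ := fun x hx => (Set.mem_iInter.1 hx []).1
  have hBm : MeasurableSet B := MeasurableSet.iInter fun w => hpre w _ hNm.compl
  refine ⟨B, fun i x => if x ∈ B then t i x else x, hBm, ?_, ?_, ?_, ?_, ?_⟩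
  · rw [hB, Set.compl_iInter]
    refine measure_iUnion_null fun w => ?_
    refine measure_mono_null (t := N ∪ {x | x ∈ Nᶜ ∧ along t w x ∈ N}) ?_
      (measure_union_null hN0 (hnull w))
    intro x hx
    simp only [Set.mem_compl_iff, Set.mem_ofPred_eq, Set.mem_union] at hx ⊢
    tauto
  · intro i
    exact measurable_ite_mem hBm
      ((hmeas [i]).comp (measurable_inclusion (show B ⊆ Nᶜ from hBN)))
  · intro i x hx
    simp only [if_pos hx]
    refine Set.mem_iInter.2 fun w => ⟨(Set.mem_iInter.1 hx [i]).2, ?_⟩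
    have := (Set.mem_iInter.1 hx (w ++ [i])).2
    rwa [along_append] at this
  · intro x hx i j hij
    simp only [if_pos hx] at hij
    exact (nbr_spec hφ (hdeg x (hBR x (hBN x hx)))).1.injective.of_comp hij
  · intro x hx y
    simp only [if_pos hx]
    exact hadj x (hBR x (hBN x hx)) y

/-! ### Edge measure and mass transport -/

/-- The measure of the set of edges from `S` to `T`. -/
def edgeMeasure {X : Type*} [MeasurableSpace X] (μ : Measure X) {d : ℕ} (s : Fin d → X → X)
    (S T : Set X) : ℝ≥0∞ :=
  ∑ i, μ (S ∩ s i ⁻¹' T)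

theorem edgeMeasure_univ_right {X : Type*} [MeasurableSpace X] (μ : Measure X) {d : ℕ}
    (s : Fin d → X → X) (S : Set X) : edgeMeasure μ s S Set.univ = d * μ S := by
  simp [edgeMeasure]

theorem edgeMeasure_mono {X : Type*} [MeasurableSpace X] (μ : Measure X) {d : ℕ}
    (s : Fin d → X → X) {S S' T T' : Set X} (hS : S ⊆ S') (hT : T ⊆ T') :
    edgeMeasure μ s S T ≤ edgeMeasure μ s S' T' :=
  Finset.sum_le_sum fun _ _ => measure_mono (Set.inter_subset_inter hS (Set.preimage_mono hT))

theorem edgeMeasure_ne_top {X : Type*} [MeasurableSpace X] (μ : Measure X) [IsFiniteMeasure μ]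
    {d : ℕ} (s : Fin d → X → X) (S T : Set X) : edgeMeasure μ s S T ≠ ∞ :=
  ENNReal.sum_ne_top.2 fun _ _ => measure_ne_top μ _

namespace Enumerates

variable {X : Type*} [MeasurableSpace X] {G : SimpleGraph X} {μ : Measure X} {d : ℕ} {B : Set X}
  {s : Fin d → X → X}

theorem adj (h : Enumerates G μ B s) {x : X} (hx : x ∈ B) (i : Fin d) : G.Adj x (s i x) :=
  (h.range x hx _).2 ⟨i, rfl⟩

theorem mem_ae (h : Enumerates G μ B s) : B ∈ ae μ := h.measure_compl

theorem measure_inter (h : Enumerates G μ B s) (S : Set X) : μ (S ∩ B) = μ S :=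
  measure_inter_conull h.measure_compl

theorem mem_of_adj (h : Enumerates G μ B s) {x y : X} (hx : x ∈ B) (hxy : G.Adj x y) : y ∈ B := by
  obtain ⟨i, rfl⟩ := (h.range x hx y).1 hxy
  exact h.mapsTo i x hx

theorem mem_of_reachable (h : Enumerates G μ B s) {x y : X} (hx : x ∈ B)
    (hxy : G.Reachable x y) : y ∈ B := by
  obtain ⟨p⟩ := hxy
  induction p with
  | nil => exact hx
  | cons hadj p ih => exact ih (h.mem_of_adj hx hadj)

theorem back (h : Enumerates G μ B s) {x : X} (hx : x ∈ B) (i : Fin d) :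
    ∃! j, s j (s i x) = x := by
  obtain ⟨j, hj⟩ := (h.range _ (h.mapsTo i x hx) x).1 (h.adj hx i).symm
  exact ⟨j, hj, fun k hk => h.injective _ (h.mapsTo i x hx) (hk.trans hj.symm)⟩

theorem neighborSet_eq (h : Enumerates G μ B s) {x : X} (hx : x ∈ B) :
    G.neighborSet x = Set.range fun i => s i x := by
  ext y
  simpa using h.range x hx y

theorem ncard_neighborSet (h : Enumerates G μ B s) {x : X} (hx : x ∈ B) :
    (G.neighborSet x).ncard = d := by
  rw [h.neighborSet_eq hx, ← Set.image_univ, Set.ncard_image_of_injective _ (h.injective x hx)]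
  simp

theorem laplacian_eq (h : Enumerates G μ B s) {x : X} (hx : x ∈ B) (f : X → ℂ) :
    laplacian G f x = ∑ i, (f x - f (s i x)) := by
  have h1 : ∑ᶠ y ∈ G.neighborSet x, f y = ∑ i, f (s i x) := by
    rw [h.neighborSet_eq hx, finsum_mem_range (h.injective x hx), finsum_eq_sum_of_fintype]
  rw [laplacian, h.ncard_neighborSet hx, h1]
  simp

/-- Mass transport: as many edges go from `S` to `T` as from `T` to `S`. -/
theorem edgeMeasure_comm [StandardBorelSpace X] (h : Enumerates G μ B s) (hpmp : IsPMP G μ)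
    {S T : Set X} (hS : MeasurableSet S) (hT : MeasurableSet T) :
    edgeMeasure μ s S T = edgeMeasure μ s T S := by
  -- On `D i j` the map `s i` is a bijection onto `D j i` with inverse `s j`. For fixed `i` the sets
  -- `D i j` partition `B`.
  set D : Fin d → Fin d → Set X := fun i j => B ∩ {x | s j (s i x) = x} with hD
  have hDm : ∀ i j, MeasurableSet (D i j) := fun i j =>
    h.measurableSet.inter (measurableSet_eq_fun ((h.measurable j).comp (h.measurable i))
      measurable_id)
  have hsplit : ∀ i (U : Set X), MeasurableSet U → μ U = ∑ j, μ (U ∩ D i j) := by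
    intro i U hU
    rw [← h.measure_inter U, ← measure_biUnion_finset]
    · congr 1
      ext x
      simp only [Set.mem_inter_iff, hD, Set.mem_iUnion, Finset.mem_univ, exists_true_left,
        Set.mem_ofPred_eq]
      constructor
      · rintro ⟨hxU, hx⟩
        obtain ⟨j, hj, -⟩ := h.back hx i
        exact ⟨j, hxU, hx, hj⟩
      · rintro ⟨j, hxU, hx, -⟩
        exact ⟨hxU, hx⟩
    · intro j _ k _ hjk
      refine Set.disjoint_left.2 fun x hx hx' => hjk ?_
      exact (h.back hx.2.1 i).unique hx.2.2 hx'.2.2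
    · exact fun j _ => hU.inter (hDm i j)
  have hmove : ∀ i j, μ (S ∩ s i ⁻¹' T ∩ D i j) = μ (T ∩ s j ⁻¹' S ∩ D j i) := by
    intro i j
    have := hpmp (D i j) (s i) (hDm i j) (h.measurable i)
      (fun x hx y hy hxy => by rw [← hx.2, ← hy.2, hxy])
      (fun x hx => (h.adj hx.1 i).reachable) (S ∩ s i ⁻¹' T ∩ D i j)
      ((hS.inter (h.measurable i hT)).inter (hDm i j)) Set.inter_subset_right
    rw [← this]
    congr 1
    ext y
    constructor
    · rintro ⟨x, ⟨⟨hxS, hxT⟩, hxB, hx⟩, rfl⟩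
      have hx : s j (s i x) = x := hx
      exact ⟨⟨hxT, by simpa [hx] using hxS⟩, h.mapsTo i x hxB, congrArg (s i) hx⟩
    · rintro ⟨⟨hyT, hyS⟩, hyB, hy⟩
      have hy : s i (s j y) = y := hy
      exact ⟨s j y, ⟨⟨hyS, by simpa [hy] using hyT⟩, h.mapsTo j y hyB, congrArg (s j) hy⟩, hy⟩
  calc edgeMeasure μ s S T = ∑ i, ∑ j, μ (S ∩ s i ⁻¹' T ∩ D i j) :=
        Finset.sum_congr rfl fun i _ => hsplit i _ (hS.inter (h.measurable i hT))
    _ = ∑ j, ∑ i, μ (T ∩ s j ⁻¹' S ∩ D j i) := by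
        rw [Finset.sum_comm]
        simp only [hmove]
    _ = edgeMeasure μ s T S :=
        (Finset.sum_congr rfl fun j _ => hsplit j _ (hT.inter (h.measurable j hS))).symm

theorem edgeMeasure_univ_left [StandardBorelSpace X] (h : Enumerates G μ B s) (hpmp : IsPMP G μ)
    {T : Set X} (hT : MeasurableSet T) : edgeMeasure μ s Set.univ T = d * μ T := by
  rw [h.edgeMeasure_comm hpmp MeasurableSet.univ hT, edgeMeasure_univ_right]

theorem measure_preimage_le [StandardBorelSpace X] (h : Enumerates G μ B s) (hpmp : IsPMP G μ)
    {T : Set X} (hT : MeasurableSet T) (i : Fin d) : μ (s i ⁻¹' T) ≤ d * μ T := by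
  rw [← h.edgeMeasure_univ_left hpmp hT, edgeMeasure]
  simp only [Set.univ_inter]
  exact Finset.single_le_sum (f := fun i => μ (s i ⁻¹' T)) (fun _ _ => zero_le) (Finset.mem_univ i)

theorem quasiMeasurePreserving [StandardBorelSpace X] (h : Enumerates G μ B s) (hpmp : IsPMP G μ)
    (i : Fin d) : Measure.QuasiMeasurePreserving (s i) μ μ := by
  refine ⟨h.measurable i, Measure.AbsolutelyContinuous.mk fun T hT hT0 => ?_⟩
  rw [Measure.map_apply (h.measurable i) hT]
  simpa [hT0] using h.measure_preimage_le hpmp hT i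

theorem quasiMeasurePreserving_along [StandardBorelSpace X] (h : Enumerates G μ B s)
    (hpmp : IsPMP G μ) (w : List (Fin d)) : Measure.QuasiMeasurePreserving (along s w) μ μ := by
  induction w with
  | nil => exact .id μ
  | cons i w ih => exact (h.quasiMeasurePreserving hpmp i).comp ih

end Enumerates

/-! ### The spectral hypothesis at test functions -/

/-- The quadratic form `⟨L f, f⟩`. -/
def energy {X : Type*} [MeasurableSpace X] (G : SimpleGraph X) (μ : Measure X) (f : Lp ℂ 2 μ) :
    ℝ :=
  (∫ x, laplacian G f x * conj (f x) ∂μ).re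

theorem energy_zero {X : Type*} [MeasurableSpace X] (G : SimpleGraph X) (μ : Measure X) :
    energy G μ 0 = 0 := by
  rw [energy, integral_eq_zero_of_ae, Complex.zero_re]
  filter_upwards [Lp.coeFn_zero ℂ 2 μ] with x hx
  have hx : (0 : Lp ℂ 2 μ) x = 0 := hx
  rw [hx]
  simp

/-- Multiplying out the denominators makes the inequality hold for zero functions too, so test
functions need not be shown to be nonzero. -/
theorem energy_mul_le {X : Type*} [MeasurableSpace X] {G : SimpleGraph X} {μ : Measure X}
    [IsFiniteMeasure μ] (hspec : ML G μ ≤ 2 * mL G μ) {f g : Lp ℂ 2 μ} (hf : f ∈ L20 μ)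
    (hg : g ∈ L20 μ) : energy G μ f * ‖g‖ ^ 2 ≤ 2 * energy G μ g * ‖f‖ ^ 2 := by
  by_cases hf0 : f = 0
  · simp [hf0, energy_zero]
  by_cases hg0 : g = 0
  · simp [hg0, energy_zero]
  have h1 : ((rayleigh G μ f : ℝ) : EReal) ≤ ML G μ :=
    le_iSup (fun f : {f : Lp ℂ 2 μ // f ∈ L20 μ ∧ f ≠ 0} => ((rayleigh G μ f.1 : ℝ) : EReal))
      ⟨f, hf, hf0⟩
  have h2 : mL G μ ≤ ((rayleigh G μ g : ℝ) : EReal) :=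
    iInf_le (fun f : {f : Lp ℂ 2 μ // f ∈ L20 μ ∧ f ≠ 0} => ((rayleigh G μ f.1 : ℝ) : EReal))
      ⟨g, hg, hg0⟩
  have h3 : ((rayleigh G μ f : ℝ) : EReal) ≤ ((2 * rayleigh G μ g : ℝ) : EReal) := by
    rw [EReal.coe_mul]
    exact (h1.trans hspec).trans (mul_le_mul_of_nonneg_left h2 (by norm_num))
  have h4 : energy G μ f / ‖f‖ ^ 2 ≤ 2 * (energy G μ g / ‖g‖ ^ 2) := EReal.coe_le_coe_iff.1 h3
  have hfp : 0 < ‖f‖ ^ 2 := by positivity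
  have hgp : 0 < ‖g‖ ^ 2 := by positivity
  rw [← mul_div_assoc, div_le_div_iff₀ hfp hgp] at h4
  exact h4

/-- `f` is integrable with integral `v`. -/
structure IntegratesTo {X : Type*} [MeasurableSpace X] (μ : Measure X) (f : X → ℝ) (v : ℝ) :
    Prop where
  integrable : Integrable f μ
  integral_eq : ∫ x, f x ∂μ = v

namespace IntegratesTo

variable {X : Type*} [MeasurableSpace X] {μ : Measure X} {f g : X → ℝ} {u v : ℝ}

theorem add (hf : IntegratesTo μ f u) (hg : IntegratesTo μ g v) :
    IntegratesTo μ (fun x => f x + g x) (u + v) :=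
  ⟨hf.1.add hg.1, by rw [integral_add hf.1 hg.1, hf.2, hg.2]⟩

theorem sub (hf : IntegratesTo μ f u) (hg : IntegratesTo μ g v) :
    IntegratesTo μ (fun x => f x - g x) (u - v) :=
  ⟨hf.1.sub hg.1, by rw [integral_sub hf.1 hg.1, hf.2, hg.2]⟩

theorem const_mul (c : ℝ) (hf : IntegratesTo μ f u) : IntegratesTo μ (fun x => c * f x) (c * u) :=
  ⟨hf.1.const_mul c, by rw [integral_const_mul, hf.2]⟩

theorem sum {ι : Type*} {t : Finset ι} {f : ι → X → ℝ} {u : ι → ℝ}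
    (hf : ∀ i, IntegratesTo μ (f i) (u i)) :
    IntegratesTo μ (fun x => ∑ i ∈ t, f i x) (∑ i ∈ t, u i) :=
  ⟨integrable_finsetSum _ fun i _ => (hf i).1, by
    rw [integral_finsetSum _ fun i _ => (hf i).1]
    exact Finset.sum_congr rfl fun i _ => (hf i).2⟩

theorem const [IsProbabilityMeasure μ] (c : ℝ) : IntegratesTo μ (fun _ => c) c :=
  ⟨integrable_const c, by simp⟩

theorem indicator_one [IsFiniteMeasure μ] {S : Set X} (hS : MeasurableSet S) :
    IntegratesTo μ (S.indicator 1) (μ.real S) :=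
  ⟨(integrable_const (1 : ℝ)).indicator hS, integral_indicator_one hS⟩

end IntegratesTo

theorem memLp_ofReal_of_bounded {X : Type*} [MeasurableSpace X] {μ : Measure X} [IsFiniteMeasure μ]
    {g : X → ℝ} (hg : Measurable g) {C : ℝ} (hC : ∀ x, |g x| ≤ C) :
    MemLp (fun x => (g x : ℂ)) 2 μ :=
  MemLp.of_bound (Complex.measurable_ofReal.comp hg).aestronglyMeasurable C
    (Filter.Eventually.of_forall fun x => by simpa using hC x)

theorem norm_toLp_ofReal_sq {X : Type*} [MeasurableSpace X] {μ : Measure X} [IsFiniteMeasure μ]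
    {g : X → ℝ} (hg : MemLp (fun x => (g x : ℂ)) 2 μ) : ‖hg.toLp _‖ ^ 2 = ∫ x, g x ^ 2 ∂μ := by
  rw [← inner_self_eq_norm_sq (𝕜 := ℂ), L2.inner_def]
  have : ∫ a, inner ℂ ((hg.toLp _) a) ((hg.toLp _) a) ∂μ = ∫ a, ((g a ^ 2 : ℝ) : ℂ) ∂μ := by
    refine integral_congr_ae ?_
    filter_upwards [hg.coeFn_toLp] with x hx
    rw [hx]
    simp [pow_two, ← Complex.ofReal_mul]
  rw [this, integral_complex_ofReal]
  simp

theorem toLp_ofReal_mem_L20 {X : Type*} [MeasurableSpace X] {μ : Measure X} [IsFiniteMeasure μ]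
    {g : X → ℝ} (hg : MemLp (fun x => (g x : ℂ)) 2 μ) (h0 : ∫ x, g x ∂μ = 0) :
    hg.toLp _ ∈ L20 μ := by
  rw [L20, Submodule.mem_orthogonal_singleton_iff_inner_right, L2.inner_def]
  have : ∫ a, inner ℂ (Lp.const 2 μ (1 : ℂ) a) ((hg.toLp _) a) ∂μ = ∫ a, ((g a : ℝ) : ℂ) ∂μ := by
    refine integral_congr_ae ?_
    filter_upwards [hg.coeFn_toLp, Lp.coeFn_const 2 μ (1 : ℂ)] with x hx hx'
    rw [hx, hx']
    simp
  rw [this, integral_complex_ofReal, h0]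
  simp

namespace Enumerates

variable {X : Type*} [MeasurableSpace X] {G : SimpleGraph X} {μ : Measure X} {d : ℕ} {B : Set X}
  {s : Fin d → X → X}

theorem energy_toLp_ofReal [StandardBorelSpace X] [IsFiniteMeasure μ] (h : Enumerates G μ B s)
    (hpmp : IsPMP G μ) {g : X → ℝ} (hg : MemLp (fun x => (g x : ℂ)) 2 μ) :
    energy G μ (hg.toLp _) = ∫ x, ∑ i, (g x - g (s i x)) * g x ∂μ := by
  have : ∫ x, laplacian G (hg.toLp _) x * conj (hg.toLp _ x) ∂μ =
      ∫ x, ((∑ i, (g x - g (s i x)) * g x : ℝ) : ℂ) ∂μ := by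
    refine integral_congr_ae ?_
    have hs : ∀ᵐ x ∂μ, ∀ i, (hg.toLp _) (s i x) = (g (s i x) : ℂ) :=
      ae_all_iff.2 fun i => (h.quasiMeasurePreserving hpmp i).ae hg.coeFn_toLp
    filter_upwards [hg.coeFn_toLp, hs, h.mem_ae] with x hx hsx hxB
    rw [h.laplacian_eq hxB, hx, Finset.sum_mul]
    push_cast
    refine Finset.sum_congr rfl fun i _ => ?_
    rw [hsx i, Complex.conj_ofReal]
  rw [energy, this, integral_complex_ofReal, Complex.ofReal_re]

/-- The quadratic form of the Laplacian, and the norm, at the centered function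
`1_S - 1_T - c`. -/
theorem exists_test_function [StandardBorelSpace X] [IsProbabilityMeasure μ]
    (h : Enumerates G μ B s) (hpmp : IsPMP G μ) {S T : Set X} (hS : MeasurableSet S)
    (hT : MeasurableSet T) (hST : Disjoint S T) :
    ∃ f ∈ L20 μ, ‖f‖ ^ 2 = μ.real S + μ.real T - (μ.real S - μ.real T) ^ 2 ∧
      energy G μ f = (edgeMeasure μ s S Sᶜ).toReal + (edgeMeasure μ s T Tᶜ).toReal +
        2 * (edgeMeasure μ s S T).toReal := by
  classical
  set a : X → ℝ := S.indicator 1 with ha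
  set b : X → ℝ := T.indicator 1 with hb
  have ham : Measurable a := measurable_one.indicator hS
  have hbm : Measurable b := measurable_one.indicator hT
  have hia : IntegratesTo μ a (μ.real S) := .indicator_one hS
  have hib : IntegratesTo μ b (μ.real T) := .indicator_one hT
  set c : ℝ := μ.real S - μ.real T with hc
  have ha01 : ∀ x, |a x| ≤ 1 := fun x => by
    by_cases hx : x ∈ S <;> simp [ha, hx]
  have hb01 : ∀ x, |b x| ≤ 1 := fun x => by
    by_cases hx : x ∈ T <;> simp [hb, hx]
  have hab : ∀ x, (a x - b x) ^ 2 = a x + b x := fun x => by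
    by_cases hx : x ∈ S
    · have := Set.disjoint_left.1 hST hx
      simp [ha, hb, hx, this]
    · by_cases hx' : x ∈ T <;> simp [ha, hb, hx, hx']
  set g : X → ℝ := fun x => a x - b x - c with hg
  have hgm : Measurable g := (ham.sub hbm).sub_const c
  have hgb : ∀ x, |g x| ≤ 2 + |c| := fun x => by
    have h1 := abs_sub (a x - b x) c
    have h2 := abs_sub (a x) (b x)
    linarith [ha01 x, hb01 x]
  have hmem := memLp_ofReal_of_bounded (μ := μ) hgm hgb
  refine ⟨hmem.toLp _, toLp_ofReal_mem_L20 hmem ?_, ?_, ?_⟩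
  · rw [((hia.sub hib).sub (.const c)).integral_eq, hc, sub_self]
  · rw [norm_toLp_ofReal_sq]
    have : ∀ x, g x ^ 2 = (a x + b x) - (2 * c * (a x - b x) - c ^ 2) := fun x => by
      rw [← hab]; simp only [hg]; ring
    simp only [this]
    rw [((hia.add hib).sub (((hia.sub hib).const_mul (2 * c)).sub (.const (c ^ 2)))).integral_eq]
    ring
  · rw [h.energy_toLp_ofReal hpmp hmem]
    have hreal : ∀ U V : Set X, (edgeMeasure μ s U V).toReal = ∑ i, μ.real (U ∩ s i ⁻¹' V) :=
      fun U V => ENNReal.toReal_sum fun _ _ => measure_ne_top μ _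
    have hprod : ∀ (U V : Set X), MeasurableSet U → MeasurableSet V → ∀ i,
        IntegratesTo μ (fun x => U.indicator (1 : X → ℝ) x * V.indicator 1 (s i x))
          (μ.real (U ∩ s i ⁻¹' V)) := by
      intro U V hU hV i
      have : (fun x => U.indicator (1 : X → ℝ) x * V.indicator 1 (s i x)) =
          (U ∩ s i ⁻¹' V).indicator 1 := by
        funext x
        rw [Set.inter_indicator_one]
        rfl
      rw [this]
      exact .indicator_one (hU.inter (h.measurable i hV))
    -- Expanding with (a - b)² = a + b. The last two terms, which carry the centering constant `c`,
    -- integrate to zero after summation over `i`, because e(X,V) = dμ(V).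
    have hexp : ∀ x i, (g x - g (s i x)) * g x =
        a x * Sᶜ.indicator 1 (s i x) + b x * Tᶜ.indicator 1 (s i x) + a x * b (s i x)
          + b x * a (s i x) - c * (a x - a (s i x)) + c * (b x - b (s i x)) := fun x i => by
      have h1 : Sᶜ.indicator (1 : X → ℝ) (s i x) = 1 - a (s i x) := by
        rw [Set.indicator_compl]; rfl
      have h2 : Tᶜ.indicator (1 : X → ℝ) (s i x) = 1 - b (s i x) := by
        rw [Set.indicator_compl]; rfl
      have h3 := hab x
      rw [h1, h2]
      simp only [hg]
      linear_combination h3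
    have hint : ∀ i, IntegratesTo μ (fun x => (g x - g (s i x)) * g x)
        (μ.real (S ∩ s i ⁻¹' Sᶜ) + μ.real (T ∩ s i ⁻¹' Tᶜ) +
          μ.real (S ∩ s i ⁻¹' T) + μ.real (T ∩ s i ⁻¹' S) - c * (μ.real S - μ.real (s i ⁻¹' S))
          + c * (μ.real T - μ.real (s i ⁻¹' T))) := by
      intro i
      have e5 := hprod Set.univ S MeasurableSet.univ hS i
      have e6 := hprod Set.univ T MeasurableSet.univ hT i
      simp only [Set.indicator_univ, Pi.one_apply, one_mul, Set.univ_inter] at e5 e6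
      simp only [hexp]
      exact (((((hprod S Sᶜ hS hS.compl i).add (hprod T Tᶜ hT hT.compl i)).add
        (hprod S T hS hT i)).add (hprod T S hT hS i)).sub ((hia.sub e5).const_mul c)).add
        ((hib.sub e6).const_mul c)
    rw [(IntegratesTo.sum hint).integral_eq]
    simp only [Finset.sum_add_distrib, Finset.sum_sub_distrib,
      ← Finset.mul_sum, ← hreal]
    have hu : ∀ V : Set X, MeasurableSet V → ∑ i, μ.real (s i ⁻¹' V) = d * μ.real V := by
      intro V hV
      have h1 := hreal Set.univ V
      rw [h.edgeMeasure_univ_left hpmp hV] at h1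
      simpa [Measure.real] using h1.symm
    rw [hu S hS, hu T hT, h.edgeMeasure_comm hpmp hT hS]
    simp
    ring

/-- The spectral hypothesis `M_L ≤ 2 m_L`, tested at functions with values in `{-1, 0, 1}`. -/
theorem spectral_le [StandardBorelSpace X] [IsProbabilityMeasure μ]
    (h : Enumerates G μ B s) (hpmp : IsPMP G μ) (hspec : ML G μ ≤ 2 * mL G μ) {S T U V : Set X}
    (hS : MeasurableSet S) (hT : MeasurableSet T) (hST : Disjoint S T)
    (hU : MeasurableSet U) (hV : MeasurableSet V) (hUV : Disjoint U V) :
    ((edgeMeasure μ s S Sᶜ).toReal + (edgeMeasure μ s T Tᶜ).toReal +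
        2 * (edgeMeasure μ s S T).toReal) *
      (μ.real U + μ.real V - (μ.real U - μ.real V) ^ 2) ≤
    2 * ((edgeMeasure μ s U Uᶜ).toReal + (edgeMeasure μ s V Vᶜ).toReal +
        2 * (edgeMeasure μ s U V).toReal) *
      (μ.real S + μ.real T - (μ.real S - μ.real T) ^ 2) := by
  obtain ⟨f, hf, hf1, hf2⟩ := h.exists_test_function hpmp hS hT hST
  obtain ⟨g, hg, hg1, hg2⟩ := h.exists_test_function hpmp hU hV hUV
  rw [← hf1, ← hg1, ← hf2, ← hg2]
  exact energy_mul_le hspec hf hg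

end Enumerates

/-! ### Components off `A`: measurability and null sets -/

/-- The component of `x` in `G ↾ (X ∖ A)`, as a set of points of `X` (empty if `x ∈ A`). -/
def comp {X : Type*} (G : SimpleGraph X) (A : Set X) (x : X) : Set X :=
  {y | ∃ (hx : x ∈ Aᶜ) (hy : y ∈ Aᶜ), (G.induce Aᶜ).Reachable ⟨x, hx⟩ ⟨y, hy⟩}

section comp

variable {X : Type*} {G : SimpleGraph X} {A : Set X} {x y : X}

theorem self_mem_comp (hx : x ∉ A) : x ∈ comp G A x :=
  ⟨hx, hx, SimpleGraph.Reachable.refl _⟩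

theorem notMem_of_mem_comp (h : y ∈ comp G A x) : y ∉ A := h.2.1

theorem comp_eq_of_mem (h : y ∈ comp G A x) : comp G A y = comp G A x := by
  obtain ⟨hx, hy, h⟩ := h
  ext z
  exact ⟨fun ⟨_, hz, h'⟩ => ⟨hx, hz, h.trans h'⟩, fun ⟨_, hz, h'⟩ => ⟨hy, hz, h.symm.trans h'⟩⟩

theorem mem_comp_of_adj (hx : x ∉ A) (hy : y ∉ A) (h : G.Adj x y) : y ∈ comp G A x :=
  ⟨hx, hy, SimpleGraph.Adj.reachable (by simpa using h)⟩

theorem reachable_of_mem_comp (h : y ∈ comp G A x) : G.Reachable x y := by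
  obtain ⟨hx, hy, h⟩ := h
  exact h.map (SimpleGraph.Embedding.induce Aᶜ).toHom

theorem encard_componentOff (hx : x ∈ Aᶜ) :
    (componentOff G A ⟨x, hx⟩).encard = (comp G A x).encard := by
  rw [← Subtype.val_injective.encard_image]
  congr 1
  ext y
  constructor
  · rintro ⟨⟨y, hy⟩, h, rfl⟩
    exact ⟨hx, hy, (SimpleGraph.ConnectedComponent.eq.1 h).symm⟩
  · rintro ⟨_, hy, h⟩
    exact ⟨⟨y, hy⟩, SimpleGraph.ConnectedComponent.eq.2 h.symm, rfl⟩

theorem mem_sizeSet {n : ℕ} : x ∈ sizeSet G A n ↔ x ∉ A ∧ (comp G A x).encard = n := by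
  constructor
  · rintro ⟨hx, h⟩
    exact ⟨hx, by rw [← encard_componentOff hx, h]⟩
  · rintro ⟨hx, h⟩
    exact ⟨hx, by rw [encard_componentOff hx, h]⟩

theorem mem_sizeSet_of_mem_comp {n : ℕ} (hx : x ∈ sizeSet G A n) (h : y ∈ comp G A x) :
    y ∈ sizeSet G A n :=
  mem_sizeSet.2 ⟨notMem_of_mem_comp h, by rw [comp_eq_of_mem h]; exact (mem_sizeSet.1 hx).2⟩

theorem sizeSet_subset_oddSet (k : ℕ) : sizeSet G A (2 * k + 1) ⊆ oddSet G A := by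
  rintro x ⟨hx, h⟩
  refine ⟨hx, Set.finite_of_encard_eq_coe h, ?_⟩
  rw [Set.ncard, h, ENat.toNat_natCast]
  exact odd_two_mul_add_one k

theorem nu_oddSet [MeasurableSpace X] (μ : Measure X) :
    nu G μ A (oddSet G A) = ∑' k : ℕ, μ (sizeSet G A (2 * k + 1)) / ((2 * k + 1 : ℕ) : ℝ≥0∞) := by
  simp only [nu, Set.inter_eq_self_of_subset_right (sizeSet_subset_oddSet _)]

end comp

open Classical in
/-- The maps `s i`, stopped when they would lead into `A`. -/
def stopAt {X : Type*} {d : ℕ} (s : Fin d → X → X) (A : Set X) (i : Fin d) (x : X) : X :=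
  if s i x ∈ A then x else s i x

theorem measurableSet_le_encard_range {ι X Y : Type*} [Countable ι] [MeasurableSpace X]
    [MeasurableSpace Y] [StandardBorelSpace Y] {f : ι → X → Y} (hf : ∀ i, Measurable (f i))
    (n : ℕ) : MeasurableSet {x | (n : ℕ∞) ≤ (Set.range fun i => f i x).encard} := by
  have : {x | (n : ℕ∞) ≤ (Set.range fun i => f i x).encard} =
      ⋃ v : Fin n → ι, ⋂ a, ⋂ b, ⋂ _ : a ≠ b, {x | f (v a) x = f (v b) x}ᶜ := by
    ext x
    simp only [Set.mem_ofPred_eq, Set.mem_iUnion, Set.mem_iInter, Set.mem_compl_iff]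
    constructor
    · intro h
      obtain ⟨t, ht, htn⟩ := Set.exists_subset_encard_eq h
      have htfin : t.Finite := Set.finite_of_encard_eq_coe htn
      lift t to Finset Y using htfin
      have hc : t.card = n := by simpa using htn
      have hmem : ∀ a : Fin n, ∃ i, f i x = (t.equivFinOfCardEq hc).symm a := fun a =>
        ht ((t.equivFinOfCardEq hc).symm a).2
      choose v hv using hmem
      refine ⟨v, fun a b hab h => hab ?_⟩
      rw [hv, hv] at h
      exact (t.equivFinOfCardEq hc).symm.injective (Subtype.ext h)
    · rintro ⟨v, hv⟩
      have hinj : Function.Injective fun a => f (v a) x := fun a b hab => by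
        by_contra hne
        exact hv a b hne hab
      calc (n : ℕ∞) = (Set.range fun a => f (v a) x).encard := by
            rw [← Set.image_univ, hinj.encard_image]; simp
        _ ≤ _ := Set.encard_le_encard (by rintro _ ⟨a, rfl⟩; exact ⟨v a, rfl⟩)
  rw [this]
  exact MeasurableSet.iUnion fun v => MeasurableSet.iInter fun a => MeasurableSet.iInter fun b =>
    MeasurableSet.iInter fun _ => (measurableSet_eq_fun (hf _) (hf _)).compl

namespace Enumerates

variable {X : Type*} [MeasurableSpace X] {G : SimpleGraph X} {μ : Measure X} {d : ℕ} {B : Set X}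
  {s : Fin d → X → X}

/-- Countably many Borel maps exhaust each component, which makes component sizes, and minima over
components, Borel on `B`. -/
theorem comp_eq_range (h : Enumerates G μ B s) {A : Set X} {x : X} (hx : x ∈ B) (hxA : x ∉ A) :
    comp G A x = Set.range fun w => along (stopAt s A) w x := by
  ext y
  constructor
  · rintro ⟨_, hy, ⟨p⟩⟩
    have key : ∀ {a b : ↥(Aᶜ)} (p : (G.induce Aᶜ).Walk a b), (a : X) ∈ B →
        ∃ w, along (stopAt s A) w a = b := by
      intro a b p
      induction p with
      | nil => exact fun _ => ⟨[], rfl⟩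
      | @cons a c b hadj p ih =>
        intro ha
        have hadj' : G.Adj a c := by simpa using hadj
        obtain ⟨i, hi⟩ := (h.range _ ha _).1 hadj'
        obtain ⟨w, hw⟩ := ih (h.mem_of_adj ha hadj')
        refine ⟨w ++ [i], ?_⟩
        have hc : s i a ∉ A := by rw [hi]; exact c.2
        have hstep : stopAt s A i a = c := by rw [stopAt, if_neg hc, hi]
        rw [along_append]
        show along _ w (stopAt s A i a) = _
        rw [hstep, hw]
    exact key p hx
  · rintro ⟨w, rfl⟩
    suffices ∀ w, along (stopAt s A) w x ∈ comp G A x ∧ along (stopAt s A) w x ∈ B from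
      (this w).1
    intro w
    induction w with
    | nil => exact ⟨self_mem_comp hxA, hx⟩
    | cons i w ih =>
      obtain ⟨h1, h2⟩ := ih
      by_cases hA : s i (along (stopAt s A) w x) ∈ A
      · simp only [along, stopAt, if_pos hA] at *
        exact ⟨h1, h2⟩
      · simp only [along, stopAt, if_neg hA] at *
        refine ⟨?_, h.mapsTo i _ h2⟩
        rw [← comp_eq_of_mem h1]
        exact mem_comp_of_adj (notMem_of_mem_comp h1) hA (h.adj h2 i)

theorem measurable_stopAt (h : Enumerates G μ B s) {A : Set X} (hA : MeasurableSet A)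
    (i : Fin d) : Measurable (stopAt s A i) := by
  unfold stopAt
  exact Measurable.ite (h.measurable i hA) measurable_id (h.measurable i)

theorem measurable_along_stopAt (h : Enumerates G μ B s) {A : Set X} (hA : MeasurableSet A)
    (w : List (Fin d)) : Measurable (along (stopAt s A) w) := by
  induction w with
  | nil => exact measurable_id
  | cons i w ih => exact (h.measurable_stopAt hA i).comp ih

theorem measurableSet_inter_sizeSet [StandardBorelSpace X] (h : Enumerates G μ B s) {A : Set X}
    (hA : MeasurableSet A) (n : ℕ) : MeasurableSet (B ∩ sizeSet G A n) := by
  have h1 := measurableSet_le_encard_range (h.measurable_along_stopAt hA)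
  convert (h.measurableSet.inter hA.compl).inter ((h1 n).diff (h1 (n + 1))) using 1
  ext x
  simp only [Set.mem_inter_iff, mem_sizeSet, Set.mem_compl_iff, Set.mem_sdiff, Set.mem_ofPred_eq]
  rw [and_assoc]
  refine and_congr_right fun hx => and_congr_right fun hxA => ?_
  rw [← h.comp_eq_range hx hxA, Nat.cast_add, Nat.cast_one,
    ENat.add_one_le_iff (ENat.natCast_ne_top n), not_lt, le_antisymm_iff, and_comm]

theorem measure_inter_sizeSet (h : Enumerates G μ B s) (A : Set X) (n : ℕ) :
    μ (B ∩ sizeSet G A n) = μ (sizeSet G A n) := by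
  rw [Set.inter_comm, h.measure_inter]

theorem comp_subset (h : Enumerates G μ B s) (A : Set X) {x : X} (hx : x ∈ B) :
    comp G A x ⊆ B :=
  fun _ hy => h.mem_of_reachable hx (reachable_of_mem_comp hy)

/-- The edges that leave a union of components of `G ↾ (X ∖ A)` lead to `A`. -/
theorem edgeMeasure_compl_le (h : Enumerates G μ B s) {A P : Set X} (hPB : P ⊆ B)
    (hPA : Disjoint P A) (hP : ∀ x ∈ P, comp G A x ⊆ P) :
    edgeMeasure μ s P Pᶜ ≤ edgeMeasure μ s P A := by
  refine Finset.sum_le_sum fun i _ => measure_mono fun x hx => ⟨hx.1, ?_⟩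
  by_contra hA
  exact hx.2 (hP x hx.1 (mem_comp_of_adj (Set.disjoint_left.1 hPA hx.1) hA (h.adj (hPB hx.1) i)))

/-- For almost every `x`, all of the countably many points reached by words from `x` avoid the
symmetric difference of `A` and `A'`, so the stopped walks agree. This reduces the Tutte condition
to Borel `A`. -/
theorem comp_ae_eq [StandardBorelSpace X] (h : Enumerates G μ B s) (hpmp : IsPMP G μ)
    {A A' : Set X} (hA : A =ᵐ[μ] A') : ∀ᵐ x ∂μ, (x ∈ A ↔ x ∈ A') ∧ comp G A x = comp G A' x := by
  have hN : ∀ᵐ x ∂μ, x ∈ A ↔ x ∈ A' := by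
    filter_upwards [hA] with x hx using iff_of_eq hx
  have hw : ∀ᵐ x ∂μ, ∀ w, along s w x ∈ A ↔ along s w x ∈ A' :=
    ae_all_iff.2 fun w => (h.quasiMeasurePreserving_along hpmp w).ae hN
  filter_upwards [hw, h.mem_ae] with x hx hxB
  refine ⟨hx [], ?_⟩
  by_cases hxA : x ∈ A
  · have hxA' := (hx []).1 hxA
    ext y
    exact ⟨fun ⟨h, _⟩ => absurd hxA h, fun ⟨h, _⟩ => absurd hxA' h⟩
  · have hxA' : x ∉ A' := fun h => hxA ((hx []).2 h)
    rw [h.comp_eq_range hxB hxA, h.comp_eq_range hxB hxA']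
    suffices ∀ w, along (stopAt s A) w x = along (stopAt s A') w x ∧
        ∃ v, along (stopAt s A) w x = along s v x from
      congrArg Set.range (funext fun w => (this w).1)
    intro w
    induction w with
    | nil => exact ⟨rfl, [], rfl⟩
    | cons i w ih =>
      obtain ⟨h1, v, h2⟩ := ih
      have h3 : s i (along (stopAt s A) w x) ∈ A ↔ s i (along (stopAt s A) w x) ∈ A' := by
        rw [h2]
        exact hx (i :: v)
      by_cases hA : s i (along (stopAt s A) w x) ∈ A
      · have hA' : s i (along (stopAt s A') w x) ∈ A' := h1 ▸ h3.1 hA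
        simp only [along]
        rw [stopAt, stopAt, if_pos hA, if_pos hA']
        exact ⟨h1, v, h2⟩
      · have hA' : s i (along (stopAt s A') w x) ∉ A' := h1 ▸ mt h3.2 hA
        simp only [along]
        rw [stopAt, stopAt, if_neg hA, if_neg hA']
        exact ⟨congrArg (s i) h1, i :: v, congrArg (s i) h2⟩

theorem nu_oddSet_congr [StandardBorelSpace X] (h : Enumerates G μ B s) (hpmp : IsPMP G μ)
    {A A' : Set X} (hA : A =ᵐ[μ] A') : nu G μ A (oddSet G A) = nu G μ A' (oddSet G A') := by
  rw [nu_oddSet, nu_oddSet]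
  refine tsum_congr fun k => ?_
  congr 1
  refine measure_congr ?_
  filter_upwards [h.comp_ae_eq hpmp hA] with x hx
  refine propext ?_
  show x ∈ sizeSet _ _ _ ↔ x ∈ sizeSet _ _ _
  rw [mem_sizeSet, mem_sizeSet, hx.1, hx.2]

theorem tutteCondition_of_measurableSet [StandardBorelSpace X] (h : Enumerates G μ B s)
    (hpmp : IsPMP G μ) {c : ℝ≥0}
    (hc : ∀ A, MeasurableSet A → nu G μ A (oddSet G A) ≤ c * μ A) : TutteCondition G μ c := by
  intro A hA
  obtain ⟨A', hA', hAA'⟩ := hA.exists_measurable_superset_ae_eq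
  rw [h.nu_oddSet_congr hpmp hAA'.2.symm, measure_congr hAA'.2.symm]
  exact hc A' hAA'.1

end Enumerates

/-! ### Test sets and small pieces -/

/-- A finite measure on `ℝ` without atoms splits into countably many small pieces. -/
theorem exists_small_partition (ν : Measure ℝ) [IsFiniteMeasure ν] (hν : ∀ r, ν {r} = 0)
    {ε : ℝ≥0∞} (hε : 0 < ε) :
    ∃ V : ℕ → Set ℝ, (∀ l, MeasurableSet (V l)) ∧ Pairwise (Function.onFun Disjoint V) ∧
      ⋃ l, V l = Set.univ ∧ ∀ l, ν (V l) ≤ ε := by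
  have h1 : ∀ r, ∃ U, {r} ⊆ U ∧ IsOpen U ∧ ν U < ε := fun r => by
    obtain ⟨U, h1, h2, h3⟩ := Set.exists_isOpen_lt_of_lt {r} ε (by rw [hν]; exact hε)
    exact ⟨U, h1, h2, h3⟩
  choose U hU hUo hUε using h1
  -- Lindelöf: countably many of these small neighborhoods cover the line.
  obtain ⟨t, ht, htU⟩ := TopologicalSpace.countable_cover_nhds fun r =>
    (hUo r).mem_nhds (hU r rfl)
  have htne : t.Nonempty := by
    rw [Set.nonempty_iff_ne_empty]
    rintro rfl
    simp at htU
    exact Set.empty_ne_univ htU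
  obtain ⟨f, rfl⟩ := ht.exists_eq_range htne
  refine ⟨disjointed fun l => U (f l), fun l => ?_, disjoint_disjointed _, ?_, fun l => ?_⟩
  · exact MeasurableSet.disjointed (fun l => (hUo (f l)).measurableSet) l
  · rw [iUnion_disjointed, ← htU, Set.biUnion_range]
  · exact (measure_mono (disjointed_subset _ l)).trans (hUε _).le

theorem edgeMeasure_iUnion {X : Type*} [MeasurableSpace X] (μ : Measure X) {d : ℕ}
    (s : Fin d → X → X) {P : ℕ → Set X} (hPm : ∀ l, MeasurableSet (P l))
    (hPd : Pairwise (Function.onFun Disjoint P)) (T : Set X) :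
    edgeMeasure μ s (⋃ l, P l) T = ∑' l, edgeMeasure μ s (P l) T := by
  set m : Measure X := ∑ i, μ.restrict (s i ⁻¹' T) with hm
  have hmE : ∀ P, MeasurableSet P → edgeMeasure μ s P T = m P := fun P hP => by
    simp [hm, edgeMeasure, Measure.restrict_apply hP]
  simp only [hmE _ (MeasurableSet.iUnion hPm), hmE _ (hPm _), measure_iUnion hPd hPm]

namespace Enumerates

variable {X : Type*} [MeasurableSpace X] {G : SimpleGraph X} {μ : Measure X} {d : ℕ} {B : Set X}
  {s : Fin d → X → X}

theorem exists_small_set [StandardBorelSpace X] [IsProbabilityMeasure μ]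
    (hatom : ∀ x, μ {x} = 0) {ε : ℝ≥0∞} (hε : 0 < ε) :
    ∃ Z, MeasurableSet Z ∧ 0 < μ Z ∧ μ Z ≤ ε := by
  obtain ⟨φ, hφ⟩ := exists_measurableEmbedding_real X
  have : IsFiniteMeasure (μ.map φ) := Measure.isFiniteMeasure_map μ φ
  obtain ⟨V, hV, -, hVu, hVε⟩ := exists_small_partition (μ.map φ) (fun r => by
    rw [Measure.map_apply hφ.measurable (measurableSet_singleton r)]
    rcases (Set.subsingleton_singleton.preimage hφ.injective).eq_empty_or_singleton with h | ⟨x, h⟩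
    · rw [h, measure_empty]
    · rw [h, hatom]) hε
  simp only [Measure.map_apply hφ.measurable (hV _)] at hVε
  by_contra! hcon
  have : μ (⋃ l, φ ⁻¹' V l) = 0 := measure_iUnion_null fun l => by
    by_contra hne
    exact absurd (hVε l) (not_le.2 (hcon _ (hφ.measurable (hV l)) (pos_iff_ne_zero.2 hne)))
  rw [← Set.preimage_iUnion, hVu, Set.preimage_univ, measure_univ] at this
  exact one_ne_zero this

/-- Embed X in the line. Each point of `B` is separated from its finitely many neighbors by a
rational interval; one of the countably many resulting independent sets has positive measure. -/
theorem exists_independent_set [StandardBorelSpace X] [IsProbabilityMeasure μ]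
    (h : Enumerates G μ B s) :
    ∃ Y, MeasurableSet Y ∧ 0 < μ Y ∧ edgeMeasure μ s Y Yᶜ = d * μ Y := by
  obtain ⟨φ, hφ⟩ := exists_measurableEmbedding_real X
  set Y : ℚ × ℚ → Set X := fun p =>
    (B ∩ φ ⁻¹' Set.Ioo (p.1 : ℝ) p.2) ∩ ⋂ i, s i ⁻¹' (φ ⁻¹' Set.Ioo (p.1 : ℝ) p.2)ᶜ with hY
  have hYm : ∀ p, MeasurableSet (Y p) := fun p =>
    (h.measurableSet.inter (hφ.measurable measurableSet_Ioo)).inter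
      (MeasurableSet.iInter fun i => h.measurable i (hφ.measurable measurableSet_Ioo).compl)
  have hcov : B ⊆ ⋃ p, Y p := by
    intro x hx
    have hopen : IsOpen (Set.range fun i => φ (s i x))ᶜ := (Set.finite_range _).isClosed.isOpen_compl
    have hmem : φ x ∈ (Set.range fun i => φ (s i x))ᶜ := by
      rintro ⟨i, hi⟩
      exact (h.adj hx i).ne (hφ.injective hi).symm
    obtain ⟨u, hu, hxu, hsub⟩ :=
      Real.isTopologicalBasis_Ioo_rat.mem_nhds_iff.1 (hopen.mem_nhds hmem)
    simp only [Set.mem_iUnion, Set.mem_singleton_iff, exists_prop] at hu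
    obtain ⟨p, q, -, rfl⟩ := hu
    refine Set.mem_iUnion.2 ⟨(p, q), ⟨hx, hxu⟩, Set.mem_iInter.2 fun i hi => hsub hi ⟨i, rfl⟩⟩
  have hpos : ∃ p, 0 < μ (Y p) := by
    by_contra! hcon
    have h0 : μ (⋃ p, Y p) = 0 := measure_iUnion_null fun p => le_antisymm (hcon p) (zero_le)
    have h1 := measure_mono_null hcov h0
    have h2 := h.measure_inter Set.univ
    rw [Set.univ_inter, h1, measure_univ] at h2
    exact zero_ne_one h2
  obtain ⟨p, hp⟩ := hpos
  refine ⟨Y p, hYm p, hp, ?_⟩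
  have : ∀ i, Y p ∩ s i ⁻¹' (Y p)ᶜ = Y p := fun i => by
    refine Set.inter_eq_left.2 fun x hx hx' => ?_
    exact Set.mem_iInter.1 hx.2 i hx'.1.2
  simp only [edgeMeasure, this]
  simp

/-- A small set together with all its neighbors: every point then has a neighbor in the set, so at
most d - 1 edges per point leave it. -/
theorem exists_small_paired_set [StandardBorelSpace X] [IsProbabilityMeasure μ]
    (h : Enumerates G μ B s) (hpmp : IsPMP G μ) (hatom : ∀ x, μ {x} = 0) (hd : 1 ≤ d)
    {ε : ℝ} (hε : 0 < ε) :
    ∃ Y, MeasurableSet Y ∧ 0 < μ.real Y ∧ μ.real Y ≤ ε ∧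
      (edgeMeasure μ s Y Yᶜ).toReal ≤ (d - 1) * μ.real Y := by
  -- Adding the neighbors multiplies the measure by at most d + 1.
  obtain ⟨Z, hZ, hZ0, hZε⟩ := exists_small_set hatom
    (ENNReal.ofReal_pos.2 (show 0 < ε / (d + 1) by positivity))
  set Y : Set X := B ∩ (Z ∪ ⋃ i, s i ⁻¹' Z) with hY
  have hYm : MeasurableSet Y :=
    h.measurableSet.inter (hZ.union (MeasurableSet.iUnion fun i => h.measurable i hZ))
  have hZY : μ Z ≤ μ Y := by
    rw [← h.measure_inter Z]
    exact measure_mono fun x hx => ⟨hx.2, Or.inl hx.1⟩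
  have hYZ : μ Y ≤ (d + 1) * μ Z := by
    calc μ Y ≤ μ (Z ∪ ⋃ i, s i ⁻¹' Z) := measure_mono Set.inter_subset_right
      _ ≤ μ Z + ∑ i, μ (s i ⁻¹' Z) :=
        (measure_union_le _ _).trans (add_le_add_right (measure_iUnion_fintype_le _ _) _)
      _ = μ Z + edgeMeasure μ s Set.univ Z := by simp [edgeMeasure]
      _ = (d + 1) * μ Z := by rw [h.edgeMeasure_univ_left hpmp hZ]; ring
  have hpair : ∀ x ∈ Y, ∃ i, s i x ∈ Y := by
    rintro x ⟨hx, hxZ | hxZ⟩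
    · obtain ⟨j, hj, -⟩ := h.back hx ⟨0, hd⟩
      refine ⟨⟨0, hd⟩, h.mapsTo _ x hx, Or.inr (Set.mem_iUnion.2 ⟨j, ?_⟩)⟩
      rw [Set.mem_preimage, hj]
      exact hxZ
    · obtain ⟨i, hi⟩ := Set.mem_iUnion.1 hxZ
      exact ⟨i, h.mapsTo i x hx, Or.inl hi⟩
  have hin : μ Y ≤ edgeMeasure μ s Y Y := by
    refine (measure_mono (t := ⋃ i, Y ∩ s i ⁻¹' Y) fun x hx => ?_).trans
      (measure_iUnion_fintype_le _ _)
    obtain ⟨i, hi⟩ := hpair x hx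
    exact Set.mem_iUnion.2 ⟨i, hx, hi⟩
  have hsum : edgeMeasure μ s Y Yᶜ + edgeMeasure μ s Y Y = d * μ Y := by
    rw [edgeMeasure, edgeMeasure, ← Finset.sum_add_distrib]
    have : ∀ i, μ (Y ∩ s i ⁻¹' Yᶜ) + μ (Y ∩ s i ⁻¹' Y) = μ Y := fun i => by
      rw [add_comm, Set.preimage_compl, ← Set.sdiff_eq, measure_inter_add_sdiff _ (h.measurable i hYm)]
    simp only [this]
    simp
  refine ⟨Y, hYm, ENNReal.toReal_pos (hZ0.trans_le hZY).ne' (measure_ne_top _ _), ?_, ?_⟩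
  · refine ENNReal.toReal_le_of_le_ofReal hε.le (hYZ.trans ?_)
    calc ((d : ℝ≥0∞) + 1) * μ Z ≤ (d + 1) * ENNReal.ofReal (ε / (d + 1)) := by gcongr
      _ = ENNReal.ofReal ε := by
        rw [show ((d : ℝ≥0∞) + 1) = ENNReal.ofReal ((d : ℝ) + 1) by
          rw [ENNReal.ofReal_add (by positivity) zero_le_one]; simp,
          ← ENNReal.ofReal_mul (by positivity), mul_div_cancel₀ _ (by positivity)]
  · have h1 := congrArg ENNReal.toReal hsum
    rw [ENNReal.toReal_add (edgeMeasure_ne_top _ _ _ _) (edgeMeasure_ne_top _ _ _ _)] at h1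
    have h2 := ENNReal.toReal_mono (edgeMeasure_ne_top _ _ _ _) hin
    simp only [ENNReal.toReal_mul, ENNReal.toReal_natCast] at h1
    change _ = d * μ.real Y at h1
    change μ.real Y ≤ _ at h2
    linarith

/-- With d = 0 every Borel subset of `B` is invariant, and a nonatomic measure has one of measure
strictly between 0 and 1. -/
theorem one_le_degree [StandardBorelSpace X] [IsProbabilityMeasure μ]
    (h : Enumerates G μ B s) (herg : IsErgodic G μ) (hatom : ∀ x, μ {x} = 0) : 1 ≤ d := by
  by_contra! hd
  obtain rfl : d = 0 := by omega
  obtain ⟨Z, hZ, hZ0, hZε⟩ := exists_small_set hatom (show (0 : ℝ≥0∞) < 1 / 2 by simp)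
  have hinv : ∀ x y, G.Reachable x y → x ∈ Z ∩ B → y ∈ Z ∩ B := by
    rintro x y ⟨p⟩ hx
    cases p with
    | nil => exact hx
    | cons hadj p =>
      obtain ⟨i, -⟩ := (h.range x hx.2 _).1 hadj
      exact i.elim0
  have := herg (Z ∩ B) (hZ.inter h.measurableSet) hinv
  rw [h.measure_inter] at this
  rcases this with h0 | h1
  · exact hZ0.ne' h0
  · rw [h1] at hZε
    norm_num at hZε

/-- An isoperimetric inequality for small sets extends to sets that split into small pieces. -/
theorem mul_measure_le_of_pieces [StandardBorelSpace X] [IsProbabilityMeasure μ]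
    {κ : ℝ} (hκ : 0 ≤ κ)
    (hiso : ∀ P, MeasurableSet P → κ * μ.real P * (1 - μ.real P) ≤ (edgeMeasure μ s P Pᶜ).toReal)
    {S T : Set X} (hS : MeasurableSet S) {F : X → ℝ} (hF : Measurable F)
    (hfib : ∀ r, μ (S ∩ F ⁻¹' {r}) = 0)
    (hST : ∀ V, edgeMeasure μ s (S ∩ F ⁻¹' V) (S ∩ F ⁻¹' V)ᶜ ≤ edgeMeasure μ s (S ∩ F ⁻¹' V) T) :
    κ * μ.real S ≤ (edgeMeasure μ s S T).toReal := by
  have hε : ∀ ε : ℝ, 0 < ε → ε < 1 → κ * (1 - ε) * μ.real S ≤ (edgeMeasure μ s S T).toReal := by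
    intro ε hε hε1
    have hνa : ∀ V, MeasurableSet V → (μ.restrict S).map F V = μ (S ∩ F ⁻¹' V) := fun V hV => by
      rw [Measure.map_apply hF hV, Measure.restrict_apply (hF hV), Set.inter_comm]
    obtain ⟨V, hV, hVd, hVu, hVε⟩ := exists_small_partition ((μ.restrict S).map F)
      (fun r => by rw [hνa _ (measurableSet_singleton r), hfib]) (ENNReal.ofReal_pos.2 hε)
    set P : ℕ → Set X := fun l => S ∩ F ⁻¹' V l with hP
    have hPm : ∀ l, MeasurableSet (P l) := fun l => hS.inter (hF (hV l))
    have hPd : Pairwise (Function.onFun Disjoint P) := fun l k hlk =>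
      ((hVd hlk).preimage F).mono Set.inter_subset_right Set.inter_subset_right
    have hPu : ⋃ l, P l = S := by
      rw [← Set.inter_iUnion, ← Set.preimage_iUnion, hVu, Set.preimage_univ, Set.inter_univ]
    have hpiece : ∀ l, ENNReal.ofReal (κ * (1 - ε)) * μ (P l) ≤ edgeMeasure μ s (P l) T := by
      intro l
      refine le_trans ?_ (hST (V l))
      have h1 : μ.real (P l) ≤ ε :=
        ENNReal.toReal_le_of_le_ofReal hε.le ((hνa _ (hV l)).symm.trans_le (hVε l))
      rw [← ENNReal.ofReal_toReal (edgeMeasure_ne_top μ s (S ∩ F ⁻¹' V l) _),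
        ← ENNReal.ofReal_toReal (measure_ne_top μ (P l)), ← ENNReal.ofReal_mul
          (mul_nonneg hκ (by linarith))]
      refine ENNReal.ofReal_le_ofReal (le_trans ?_ (hiso _ (hPm l)))
      change κ * (1 - ε) * μ.real (P l) ≤ _
      have h2 : 0 ≤ κ * μ.real (P l) := mul_nonneg hκ measureReal_nonneg
      nlinarith
    have htot : ENNReal.ofReal (κ * (1 - ε)) * μ S ≤ edgeMeasure μ s S T := by
      rw [← hPu, edgeMeasure_iUnion μ s hPm hPd, measure_iUnion hPd hPm, ← ENNReal.tsum_mul_left]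
      exact ENNReal.tsum_le_tsum hpiece
    have := ENNReal.toReal_mono (edgeMeasure_ne_top _ _ _ _) htot
    rwa [ENNReal.toReal_mul, ENNReal.toReal_ofReal (mul_nonneg hκ (by linarith))] at this
  have hlim : Filter.Tendsto (fun ε : ℝ => κ * (1 - ε) * μ.real S) (nhdsWithin 0 (Set.Ioi 0))
      (nhds (κ * (1 - 0) * μ.real S)) :=
    ((by fun_prop : Continuous fun ε : ℝ => κ * (1 - ε) * μ.real S).tendsto 0).mono_left
      nhdsWithin_le_nhds
  have := le_of_tendsto hlim (b := (edgeMeasure μ s S T).toReal) (by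
    filter_upwards [Ioo_mem_nhdsGT (show (0 : ℝ) < 1 by norm_num)] with ε hε'
    exact hε ε hε'.1 hε'.2)
  simpa using this

end Enumerates

/-! ### The nonatomic case -/

theorem edgeMeasure_empty_left {X : Type*} [MeasurableSpace X] (μ : Measure X) {d : ℕ}
    (s : Fin d → X → X) (T : Set X) : edgeMeasure μ s ∅ T = 0 := by
  simp [edgeMeasure]

theorem edgeMeasure_empty_right {X : Type*} [MeasurableSpace X] (μ : Measure X) {d : ℕ}
    (s : Fin d → X → X) (S : Set X) : edgeMeasure μ s S ∅ = 0 := by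
  simp [edgeMeasure]

namespace Enumerates

variable {X : Type*} [MeasurableSpace X] {G : SimpleGraph X} {μ : Measure X} {d : ℕ} {B : Set X}
  {s : Fin d → X → X}

/-- The independent set `Y` has energy dμ(Y) and squared norm at most μ(Y), so M_L ≥ d and m_L ≥
d/2. -/
theorem half_degree_mul_le [StandardBorelSpace X] [IsProbabilityMeasure μ]
    (h : Enumerates G μ B s) (hpmp : IsPMP G μ) (hspec : ML G μ ≤ 2 * mL G μ) {P : Set X}
    (hP : MeasurableSet P) :
    (d / 2 : ℝ) * μ.real P * (1 - μ.real P) ≤ (edgeMeasure μ s P Pᶜ).toReal := by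
  obtain ⟨Y, hY, hY0, hYe⟩ := h.exists_independent_set
  have key := h.spectral_le hpmp hspec hY MeasurableSet.empty (Set.disjoint_empty Y) hP
    MeasurableSet.empty (Set.disjoint_empty P)
  simp only [edgeMeasure_empty_left, edgeMeasure_empty_right, hYe, ENNReal.toReal_mul,
    ENNReal.toReal_natCast, ENNReal.toReal_zero, measureReal_empty, add_zero, sub_zero,
    mul_zero] at key
  change d * μ.real Y * _ ≤ _ at key
  have hy : 0 < μ.real Y := ENNReal.toReal_pos hY0.ne' (measure_ne_top _ _)
  have he : 0 ≤ (edgeMeasure μ s P Pᶜ).toReal := ENNReal.toReal_nonneg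
  have h1 : 0 ≤ (edgeMeasure μ s P Pᶜ).toReal * μ.real Y ^ 2 := by positivity
  refine le_of_mul_le_mul_right ?_ hy
  nlinarith

/-- This is M_L ≤ 2(d - 1): paired sets of measure at most ε have Rayleigh quotient at most (d -
1)/(1 - ε), and ε tends to 0. -/
theorem quadratic_form_le [StandardBorelSpace X] [IsProbabilityMeasure μ]
    (h : Enumerates G μ B s) (hpmp : IsPMP G μ) (hspec : ML G μ ≤ 2 * mL G μ)
    (hatom : ∀ x, μ {x} = 0) (hd : 1 ≤ d) {S T : Set X} (hS : MeasurableSet S)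
    (hT : MeasurableSet T) (hST : Disjoint S T) :
    (edgeMeasure μ s S Sᶜ).toReal + (edgeMeasure μ s T Tᶜ).toReal +
        2 * (edgeMeasure μ s S T).toReal ≤ 2 * (d - 1) * (μ.real S + μ.real T) := by
  set q : ℝ := (edgeMeasure μ s S Sᶜ).toReal + (edgeMeasure μ s T Tᶜ).toReal +
        2 * (edgeMeasure μ s S T).toReal with hq
  have hd' : (1 : ℝ) ≤ d := by exact_mod_cast hd
  have hq0 : 0 ≤ q := by positivity
  have hε : ∀ ε : ℝ, 0 < ε → q * (1 - ε) ≤ 2 * (d - 1) * (μ.real S + μ.real T) := by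
    intro ε hε
    obtain ⟨Y, hY, hY0, hYε, hYe⟩ := h.exists_small_paired_set hpmp hatom hd hε
    have key := h.spectral_le hpmp hspec hS hT hST hY MeasurableSet.empty (Set.disjoint_empty Y)
    simp only [edgeMeasure_empty_left, edgeMeasure_empty_right, ENNReal.toReal_zero,
      measureReal_empty, add_zero, sub_zero, mul_zero, ← hq] at key
    refine le_of_mul_le_mul_right ?_ hY0
    set y := μ.real Y
    set v := μ.real S + μ.real T with hv
    have hv0 : 0 ≤ v := by positivity
    calc q * (1 - ε) * y = q * (y - ε * y) := by ring
      _ ≤ q * (y - y ^ 2) := by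
        refine mul_le_mul_of_nonneg_left ?_ hq0
        nlinarith
      _ ≤ 2 * (edgeMeasure μ s Y Yᶜ).toReal * (v - (μ.real S - μ.real T) ^ 2) := key
      _ ≤ 2 * (edgeMeasure μ s Y Yᶜ).toReal * v := by
        refine mul_le_mul_of_nonneg_left (by nlinarith [sq_nonneg (μ.real S - μ.real T)])
          (by positivity)
      _ ≤ 2 * ((d - 1) * y) * v := by gcongr
      _ = 2 * (d - 1) * v * y := by ring
  have hlim : Filter.Tendsto (fun ε : ℝ => q * (1 - ε)) (nhdsWithin 0 (Set.Ioi 0))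
      (nhds (q * (1 - 0))) :=
    ((by fun_prop : Continuous fun ε : ℝ => q * (1 - ε)).tendsto 0).mono_left
      nhdsWithin_le_nhds
  have := le_of_tendsto hlim (b := 2 * (d - 1) * (μ.real S + μ.real T)) (by
    filter_upwards [self_mem_nhdsWithin] with ε hε'
    exact hε ε hε')
  simpa using this

/-- Every neighbor of an isolated point of `G ↾ (X ∖ A)` lies in `A`. -/
theorem edgeMeasure_sizeSet_one (h : Enumerates G μ B s) (A : Set X) :
    edgeMeasure μ s (B ∩ sizeSet G A 1) A = d * μ (B ∩ sizeSet G A 1) := by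
  have : ∀ i, B ∩ sizeSet G A 1 ∩ s i ⁻¹' A = B ∩ sizeSet G A 1 := fun i => by
    refine Set.inter_eq_left.2 fun x ⟨hx, hx1⟩ => ?_
    obtain ⟨hxA, hc⟩ := mem_sizeSet.1 hx1
    by_contra hA
    obtain ⟨z, hz⟩ := Set.encard_eq_one.1 (by simpa using hc)
    have h1 := mem_comp_of_adj hxA hA (h.adj hx i)
    have h2 := self_mem_comp (G := G) hxA
    rw [hz, Set.mem_singleton_iff] at h1 h2
    exact (h.adj hx i).ne (h2.trans h1.symm)
  simp only [edgeMeasure, this]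
  simp

theorem half_degree_mul_sizeSet_le [StandardBorelSpace X] [IsProbabilityMeasure μ]
    (h : Enumerates G μ B s) (hpmp : IsPMP G μ) (hspec : ML G μ ≤ 2 * mL G μ)
    (hatom : ∀ x, μ {x} = 0) {A : Set X} (hA : MeasurableSet A) (n : ℕ) :
    (d / 2 : ℝ) * μ.real (B ∩ sizeSet G A n) ≤ (edgeMeasure μ s (B ∩ sizeSet G A n) A).toReal := by
  have : NullSingletonClass μ := ⟨hatom⟩
  obtain ⟨φ, hφ⟩ := exists_measurableEmbedding_real X
  -- The minimum of `φ` over the component: constant on each component and distinct on distinct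
  -- ones, so each fiber in the size-`n` set is empty or one finite component, hence null.
  set F : X → ℝ := fun x => ⨅ w, φ (along (stopAt s A) w x) with hF
  have hFm : Measurable F := Measurable.iInf fun w =>
    hφ.measurable.comp (h.measurable_along_stopAt hA w)
  have hFc : ∀ x ∈ B ∩ sizeSet G A n, F x = sInf (φ '' comp G A x) := fun x hx => by
    rw [h.comp_eq_range hx.1 (mem_sizeSet.1 hx.2).1, ← Set.range_comp]
    rfl
  have hFmem : ∀ x ∈ B ∩ sizeSet G A n, ∃ y ∈ comp G A x, φ y = F x := fun x hx => by
    rw [hFc x hx]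
    obtain ⟨hxA, hc⟩ := mem_sizeSet.1 hx.2
    have hne : (φ '' comp G A x).Nonempty := ⟨_, x, self_mem_comp hxA, rfl⟩
    exact hne.csInf_mem ((Set.finite_of_encard_eq_coe hc).image φ)
  refine mul_measure_le_of_pieces (by positivity) (fun P hP => h.half_degree_mul_le hpmp hspec hP)
    (h.measurableSet_inter_sizeSet hA n) hFm (fun r => ?_) fun V => ?_
  · rcases (B ∩ sizeSet G A n ∩ F ⁻¹' {r}).eq_empty_or_nonempty with h0 | ⟨x, hx, hxr⟩
    · rw [h0, measure_empty]
    · have hfin := Set.finite_of_encard_eq_coe (mem_sizeSet.1 hx.2).2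
      refine measure_mono_null (fun z hz => ?_) (hfin.measure_zero μ)
      obtain ⟨y, hy, hyF⟩ := hFmem x hx
      obtain ⟨y', hy', hyF'⟩ := hFmem z hz.1
      have : y = y' := hφ.injective (by rw [hyF, hyF', hxr, hz.2])
      subst this
      rw [← comp_eq_of_mem hy, comp_eq_of_mem hy']
      exact self_mem_comp (mem_sizeSet.1 hz.1.2).1
  · refine h.edgeMeasure_compl_le (fun x hx => hx.1.1)
      (Set.disjoint_left.2 fun x hx => (mem_sizeSet.1 hx.1.2).1) fun x hx y hy => ?_
    have hyS : y ∈ B ∩ sizeSet G A n :=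
      ⟨h.comp_subset A hx.1.1 hy, mem_sizeSet_of_mem_comp hx.1.2 hy⟩
    refine ⟨hyS, ?_⟩
    have : F y = F x := by rw [hFc x hx.1, hFc y hyS, comp_eq_of_mem hy]
    rw [Set.mem_preimage, this]
    exact hx.2

theorem tsum_edgeMeasure_sizeSet_le [StandardBorelSpace X] (h : Enumerates G μ B s)
    (hpmp : IsPMP G μ) {A : Set X} (hA : MeasurableSet A) :
    ∑' k : ℕ, edgeMeasure μ s (B ∩ sizeSet G A (2 * k + 1)) A ≤ d * μ A := by
  rw [← edgeMeasure_iUnion μ s (fun k => h.measurableSet_inter_sizeSet hA _)]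
  · calc _ ≤ edgeMeasure μ s Set.univ A := edgeMeasure_mono μ s (Set.subset_univ _) subset_rfl
      _ = d * μ A := h.edgeMeasure_univ_left hpmp hA
  · intro k l hkl
    refine Set.disjoint_left.2 fun x hx hx' => hkl ?_
    have := (mem_sizeSet.1 hx.2).2.symm.trans (mem_sizeSet.1 hx'.2).2
    have : 2 * k + 1 = 2 * l + 1 := by exact_mod_cast this
    omega

/-- In the quadratic form of 1_I - 1_A, the terms e(I,Iᶜ), e(A,Aᶜ) and e(I,A) are each at least
e(I,A) = dμ(I), whence 4dμ(I) ≤ 2(d - 1)(μ(I) + μ(A)). -/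
theorem isolated_le [StandardBorelSpace X] [IsProbabilityMeasure μ]
    (h : Enumerates G μ B s) (hpmp : IsPMP G μ) (hspec : ML G μ ≤ 2 * mL G μ)
    (hatom : ∀ x, μ {x} = 0) (hd : 1 ≤ d) {A : Set X} (hA : MeasurableSet A) :
    (d + 1) * μ.real (B ∩ sizeSet G A 1) ≤ (d - 1) * μ.real A := by
  set I := B ∩ sizeSet G A 1 with hI
  have hIm : MeasurableSet I := h.measurableSet_inter_sizeSet hA 1
  have hIA : Disjoint I A := Set.disjoint_left.2 fun x hx => (mem_sizeSet.1 hx.2).1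
  have key := h.quadratic_form_le hpmp hspec hatom hd hIm hA hIA
  have h1 : (edgeMeasure μ s I A).toReal = d * μ.real I := by
    rw [hI, h.edgeMeasure_sizeSet_one, ENNReal.toReal_mul, ENNReal.toReal_natCast]
    rfl
  have h2 : (edgeMeasure μ s I A).toReal ≤ (edgeMeasure μ s I Iᶜ).toReal :=
    ENNReal.toReal_mono (edgeMeasure_ne_top _ _ _ _)
      (edgeMeasure_mono μ s subset_rfl hIA.subset_compl_left)
  have h3 : (edgeMeasure μ s I A).toReal ≤ (edgeMeasure μ s A Aᶜ).toReal := by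
    rw [h.edgeMeasure_comm hpmp hIm hA]
    exact ENNReal.toReal_mono (edgeMeasure_ne_top _ _ _ _)
      (edgeMeasure_mono μ s subset_rfl hIA.subset_compl_right)
  rw [h1] at key h2 h3
  linarith

theorem nu_le_of_nonatomic [StandardBorelSpace X] [IsProbabilityMeasure μ]
    (h : Enumerates G μ B s) (hpmp : IsPMP G μ) (hspec : ML G μ ≤ 2 * mL G μ)
    (hatom : ∀ x, μ {x} = 0) (hd : 1 ≤ d) {A : Set X} (hA : MeasurableSet A) :
    nu G μ A (oddSet G A) ≤ (Real.toNNReal (1 - 2 / (3 * (d + 1))) : ℝ≥0∞) * μ A := by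
  have hd' : (1 : ℝ) ≤ d := by exact_mod_cast hd
  have hd0 : (d : ℝ≥0∞) ≠ 0 := by simp; omega
  set a : ℕ → ℝ≥0∞ := fun k => μ (B ∩ sizeSet G A (2 * k + 1)) / ((2 * k + 1 : ℕ) : ℝ≥0∞) with ha
  have hnu : nu G μ A (oddSet G A) = a 0 + ∑' k, a (k + 1) := by
    rw [nu_oddSet, ← tsum_eq_zero_add' ENNReal.summable]
    simp only [ha, h.measure_inter_sizeSet]
  have ha0 : a 0 = μ (B ∩ sizeSet G A 1) := by simp [ha]
  -- Here the components have 2(k+1) + 1 ≥ 3 vertices, which is the source of the factor 3.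
  have hak : ∀ k, 3 * (d * a (k + 1)) ≤ 2 * edgeMeasure μ s (B ∩ sizeSet G A (2 * (k + 1) + 1)) A := by
    intro k
    have h1 := h.half_degree_mul_sizeSet_le hpmp hspec hatom hA (2 * (k + 1) + 1)
    have hne : (3 * (d * a (k + 1)) : ℝ≥0∞) ≠ ∞ := by
      refine ENNReal.mul_ne_top (by simp) (ENNReal.mul_ne_top (by simp)
        (ENNReal.div_ne_top (measure_ne_top _ _) (by simp)))
    rw [← ENNReal.toReal_le_toReal hne
      (ENNReal.mul_ne_top (by simp) (edgeMeasure_ne_top _ _ _ _))]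
    simp only [ENNReal.toReal_mul, ha, ENNReal.toReal_div, ENNReal.toReal_natCast,
      ENNReal.toReal_ofNat]
    change 3 * (d * (μ.real (B ∩ sizeSet G A (2 * (k + 1) + 1)) / _)) ≤ _
    set x := μ.real (B ∩ sizeSet G A (2 * (k + 1) + 1))
    have hx : 0 ≤ x := measureReal_nonneg
    have h2 : x / ((2 * (k + 1) + 1 : ℕ) : ℝ) ≤ x / 3 := by
      refine div_le_div_of_nonneg_left hx (by norm_num) ?_
      push_cast
      linarith [(Nat.cast_nonneg k : (0 : ℝ) ≤ k)]
    have h3 := mul_le_mul_of_nonneg_left h2 (show (0 : ℝ) ≤ d by positivity)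
    linarith
  have hsum : 2 * a 0 + 3 * ∑' k, a (k + 1) ≤ 2 * μ A := by
    have h1 := h.tsum_edgeMeasure_sizeSet_le hpmp hA
    rw [tsum_eq_zero_add' ENNReal.summable] at h1
    have h0 : edgeMeasure μ s (B ∩ sizeSet G A (2 * 0 + 1)) A = d * a 0 := by
      rw [ha0]; exact h.edgeMeasure_sizeSet_one A
    rw [h0] at h1
    have h2 : 3 * (d * ∑' k, a (k + 1)) ≤
        2 * ∑' k, edgeMeasure μ s (B ∩ sizeSet G A (2 * (k + 1) + 1)) A := by
      simp only [← ENNReal.tsum_mul_left]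
      exact ENNReal.tsum_le_tsum hak
    refine (ENNReal.mul_le_mul_iff_right hd0 (by simp)).1 ?_
    calc (d : ℝ≥0∞) * (2 * a 0 + 3 * ∑' k, a (k + 1)) =
          2 * (d * a 0) + 3 * (d * ∑' k, a (k + 1)) := by ring
      _ ≤ 2 * (d * a 0) + 2 * ∑' k, edgeMeasure μ s (B ∩ sizeSet G A (2 * (k + 1) + 1)) A := by
        gcongr
      _ ≤ 2 * (d * μ A) := by
        rw [← mul_add]
        gcongr
      _ = d * (2 * μ A) := by ring
  have hI := h.isolated_le hpmp hspec hatom hd hA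
  set t := ∑' k, a (k + 1) with ht
  have htop : (2 * μ A : ℝ≥0∞) ≠ ∞ := ENNReal.mul_ne_top (by simp) (measure_ne_top _ _)
  have ha0t : a 0 ≠ ∞ := by rw [ha0]; exact measure_ne_top _ _
  have ht3 : (3 * t : ℝ≥0∞) ≠ ∞ := ne_top_of_le_ne_top htop (le_add_self.trans hsum)
  have htt : t ≠ ∞ := fun h => ht3 (by rw [h]; simp)
  have hsum' := ENNReal.toReal_mono htop hsum
  rw [ENNReal.toReal_add (ENNReal.mul_ne_top (by simp) ha0t) ht3] at hsum'
  simp only [ENNReal.toReal_mul, ENNReal.toReal_ofNat] at hsum'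
  have hI0 : (a 0).toReal = μ.real (B ∩ sizeSet G A 1) := by rw [ha0]; rfl
  rw [← hI0] at hI
  change _ ≤ 2 * μ.real A at hsum'
  have hc : (0 : ℝ) ≤ 1 - 2 / (3 * (d + 1)) := by
    rw [sub_nonneg, div_le_one (by positivity)]
    linarith
  rw [hnu, ← ENNReal.toReal_le_toReal (ENNReal.add_ne_top.2 ⟨ha0t, htt⟩)
    (ENNReal.mul_ne_top (by simp) (measure_ne_top _ _)), ENNReal.toReal_add ha0t htt,
    ENNReal.toReal_mul, ENNReal.coe_toReal, Real.coe_toNNReal _ hc]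
  change _ ≤ _ * μ.real A
  -- With t the contribution of sizes at least 3, `hsum'` gives a₀ + t ≤ a₀/3 + (2/3)μ(A); this
  -- bound on a₀ finishes.
  have hI2 : (a 0).toReal ≤ (1 - 2 / (d + 1)) * μ.real A := by
    have : (1 - 2 / ((d : ℝ) + 1)) * μ.real A = (d - 1) * μ.real A / (d + 1) := by
      field_simp; ring
    rw [this, le_div_iff₀ (by positivity)]
    linarith
  have : (2 : ℝ) / (3 * (d + 1)) = (2 / (d + 1)) / 3 := by field_simp
  rw [this]
  linarith

theorem strictTutteCondition_of_nonatomic [StandardBorelSpace X] [IsProbabilityMeasure μ]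
    (h : Enumerates G μ B s) (hpmp : IsPMP G μ) (herg : IsErgodic G μ)
    (hspec : ML G μ ≤ 2 * mL G μ) (hatom : ∀ x, μ {x} = 0) : StrictTutteCondition G μ := by
  have hd := h.one_le_degree herg hatom
  refine ⟨Real.toNNReal (1 - 2 / (3 * (d + 1))), ?_, h.tutteCondition_of_measurableSet hpmp
    fun A hA => h.nu_le_of_nonatomic hpmp hspec hatom hd hA⟩
  rw [Real.toNNReal_lt_one]
  have : (0 : ℝ) < 2 / (3 * (d + 1)) := by positivity
  linarith

/-! ### The atomic case -/

open Classical in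
/-- If an ergodic pmp graph has an atom, then, up to a null set, it is finite and connected, and
the measure is uniform. -/
theorem exists_uniform_of_atom [StandardBorelSpace X] [IsProbabilityMeasure μ]
    (h : Enumerates G μ B s) (hpmp : IsPMP G μ) (herg : IsErgodic G μ) {x₀ : X}
    (hx₀ : μ {x₀} ≠ 0) :
    ∃ V : Finset X, x₀ ∈ V ∧ (V : Set X) ⊆ B ∧ {x | μ {x} ≠ 0} = V ∧
      (∀ S, μ.real S = (V.filter (· ∈ S)).card / V.card) ∧
      ∀ x ∈ V, ∀ y, G.Reachable x y ↔ y ∈ V := by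
  have hmemB : x₀ ∈ B := by
    by_contra hB
    exact hx₀ (measure_mono_null (Set.singleton_subset_iff.2 hB) h.measure_compl)
  set C : Set X := {y | G.Reachable x₀ y} with hC
  have hCinv : ∀ x y, G.Reachable x y → x ∈ C → y ∈ C := fun x y hxy hx =>
    SimpleGraph.Reachable.trans hx hxy
  -- The constant map on {x₀} is an admissible partial injection, so all points of the component
  -- have equal mass.
  have hmass : ∀ y ∈ C, μ {y} = μ {x₀} := fun y hy => by
    have := hpmp {x₀} (fun _ => y) (measurableSet_singleton x₀) measurable_const
      (Set.injOn_singleton _ _) (fun x hx => by rw [Set.mem_singleton_iff.1 hx]; exact hy) {x₀}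
      (measurableSet_singleton x₀) subset_rfl
    simpa using this
  have hfin : C.Finite := by
    by_contra hinf
    obtain ⟨n, hn⟩ := ENNReal.exists_nat_mul_gt hx₀ ENNReal.one_ne_top
    obtain ⟨t, ht, htn⟩ := Set.Infinite.exists_subset_card_eq hinf n
    have : μ (t : Set X) = n * μ {x₀} := by
      rw [← sum_measure_singleton, Finset.sum_congr rfl fun y hy => hmass y (ht hy),
        Finset.sum_const, htn, nsmul_eq_mul]
    exact absurd (prob_le_one (μ := μ) (s := (t : Set X))) (by rw [this]; exact not_le.2 hn)
  have hC1 : μ C = 1 := by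
    refine (herg C hfin.measurableSet hCinv).resolve_left fun h0 => hx₀ ?_
    exact measure_mono_null (Set.singleton_subset_iff.2 (SimpleGraph.Reachable.refl x₀)) h0
  have hCc : μ Cᶜ = 0 := (prob_compl_eq_zero_iff hfin.measurableSet).2 hC1
  lift C to Finset X using hfin with V hV
  have hmemV : ∀ y, y ∈ V ↔ G.Reachable x₀ y := fun y => by
    rw [← Finset.mem_coe, hC]; rfl
  have hx₀V : x₀ ∈ V := (hmemV _).2 (SimpleGraph.Reachable.refl x₀)
  have hreal : ∀ t : Finset X, t ⊆ V → μ.real (t : Set X) = t.card * μ.real {x₀} := by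
    intro t ht
    rw [Measure.real, ← sum_measure_singleton,
      Finset.sum_congr rfl fun y hy => hmass y (Finset.mem_coe.2 (ht hy)), Finset.sum_const,
      nsmul_eq_mul, ENNReal.toReal_mul, ENNReal.toReal_natCast]
    rfl
  have hcard : (V.card : ℝ) * μ.real {x₀} = 1 := by
    rw [← hreal V subset_rfl, Measure.real, hC1, ENNReal.toReal_one]
  have hVpos : (0 : ℝ) < V.card := by exact_mod_cast Finset.card_pos.2 ⟨x₀, hx₀V⟩
  refine ⟨V, hx₀V, fun y hy => h.mem_of_reachable hmemB ((hmemV y).1 hy), ?_, fun S => ?_, ?_⟩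
  · ext y
    constructor
    · intro hy
      by_contra hyV
      exact hy (measure_mono_null (Set.singleton_subset_iff.2 hyV) hCc)
    · intro hy
      exact (hmass y hy).trans_ne hx₀
  · have h1 : μ.real S = μ.real ((V.filter (· ∈ S) : Finset X) : Set X) := by
      rw [Measure.real, Measure.real, ← measure_inter_conull hCc]
      congr 2
      ext y
      simp [and_comm]
    rw [h1, hreal _ (Finset.filter_subset _ _), eq_div_iff hVpos.ne', mul_assoc,
      mul_comm (μ.real _), hcard, mul_one]
  · intro x hx y
    rw [hmemV] at hx ⊢
    exact ⟨hx.trans, hx.symm.trans⟩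

open Classical in
-- Count edges into `A`: odd components with at most n/2 vertices each send at least d, at most one
-- odd component is larger, and parity removes the remaining excess of one.
theorem tutteCondition_of_atom [StandardBorelSpace X] [IsProbabilityMeasure μ]
    (h : Enumerates G μ B s) (hpmp : IsPMP G μ) (herg : IsErgodic G μ)
    (hspec : ML G μ ≤ 2 * mL G μ) {x₀ : X} (hx₀ : μ {x₀} ≠ 0)
    (heven : Even {x : X | μ {x} ≠ 0}.ncard) : TutteCondition G μ 1 := by
  obtain ⟨V, hx₀V, hVB, hVatoms, hμ, hconn⟩ := h.exists_uniform_of_atom hpmp herg hx₀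
  rw [hVatoms, Set.ncard_coe_finset] at heven
  refine h.tutteCondition_of_measurableSet hpmp fun A hA => ?_
  set n := V.card with hn
  have hn0 : 0 < n := Finset.card_pos.2 ⟨x₀, hx₀V⟩
  have hnR : (0 : ℝ) < n := by exact_mod_cast hn0
  set c : Set X → X → ℕ := fun T x => (Finset.univ.filter fun i => s i x ∈ T).card with hc
  have hedge : ∀ S T : Set X, (edgeMeasure μ s S T).toReal =
      ((∑ x ∈ V.filter (· ∈ S), c T x : ℕ) : ℝ) / n := by
    intro S T
    rw [edgeMeasure, ENNReal.toReal_sum fun _ _ => measure_ne_top μ _]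
    change ∑ i, μ.real _ = _
    simp only [hμ, ← Finset.sum_div]
    congr 1
    rw [← Nat.cast_sum]
    congr 1
    simp only [hc, Finset.card_filter]
    rw [Finset.sum_comm, Finset.sum_filter]
    refine Finset.sum_congr rfl fun x _ => ?_
    by_cases hx : x ∈ S <;> simp [hx]
  -- Evenness rules out a single vertex, so connectedness provides an edge.
  obtain ⟨y₀, hy₀⟩ : ∃ y, G.Adj x₀ y := by
    have h1 : 1 < V.card := by
      obtain ⟨k, hk⟩ := heven
      omega
    obtain ⟨y, hy, hne⟩ := Finset.exists_mem_ne h1 x₀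
    obtain ⟨p⟩ := (hconn x₀ hx₀V y).2 hy
    cases p with
    | nil => exact absurd rfl hne
    | cons hadj p => exact ⟨_, hadj⟩
  obtain ⟨i₀, hi₀⟩ := (h.range x₀ (hVB hx₀V) y₀).1 hy₀
  have hd : 0 < d := i₀.pos
  have hy₀V : y₀ ∈ V := (hconn x₀ hx₀V y₀).1 hy₀.reachable
  have hfilter : ∀ x ∈ V, ∀ S : Set X, S = {x} → V.filter (· ∈ S) = {x} := by
    rintro x hx S rfl
    ext z
    simp only [Finset.mem_filter, Set.mem_singleton_iff, Finset.mem_singleton]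
    exact ⟨fun hz => hz.2, fun hz => ⟨hz ▸ hx, hz⟩⟩
  have hself : ∀ x ∈ V, ∀ S : Set X, S = {x}ᶜ → c S x = d := by
    intro x hx S hS
    refine (congrArg Finset.card (Finset.filter_true_of_mem fun i _ => ?_)).trans
      (Finset.card_fin d)
    rw [hS]
    exact (h.adj (hVB hx) i).ne'
  -- The function 1_{x₀} - 1_{y₀} has energy at least 2(d+1)/n and squared norm 2/n.
  have hiso : ∀ U, MeasurableSet U →
      (d + 1) * (μ.real U - μ.real U ^ 2) ≤ 2 * (edgeMeasure μ s U Uᶜ).toReal := by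
    intro U hU
    have key := h.spectral_le hpmp hspec (measurableSet_singleton x₀) (measurableSet_singleton y₀)
      (Set.disjoint_singleton.2 hy₀.ne) hU MeasurableSet.empty (Set.disjoint_empty U)
    have h1 : 1 ≤ c {y₀} x₀ := Finset.card_pos.2 ⟨i₀, by simp [hi₀]⟩
    have h1' : (1 : ℝ) ≤ c {y₀} x₀ := by exact_mod_cast h1
    have h2 : 0 ≤ μ.real U - μ.real U ^ 2 := by
      nlinarith [measureReal_nonneg (μ := μ) (s := U), measureReal_le_one (μ := μ) (s := U)]
    rw [hedge {x₀}, hedge {y₀}, hedge {x₀}, hμ {x₀}, hμ {y₀}, hfilter _ hx₀V _ rfl, hfilter _ hy₀V _ rfl] at key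
    simp only [edgeMeasure_empty_left, edgeMeasure_empty_right, ENNReal.toReal_zero,
      measureReal_empty, add_zero, sub_zero, mul_zero, Finset.sum_singleton, hself _ hx₀V _ rfl,
      hself _ hy₀V _ rfl, Finset.card_singleton, Nat.cast_one, sub_self] at key
    have h3 : (d / n + d / n + 2 * (1 / n)) * (μ.real U - μ.real U ^ 2) ≤
        (d / n + d / n + 2 * (c {y₀} x₀ / n)) * (μ.real U - μ.real U ^ 2) := by gcongr
    have h4 := h3.trans key
    have h5 : (2 * (d + 1) * (μ.real U - μ.real U ^ 2)) / n ≤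
        (4 * (edgeMeasure μ s U Uᶜ).toReal) / n := by
      calc _ = (d / n + d / n + 2 * (1 / n)) * (μ.real U - μ.real U ^ 2) := by ring
        _ ≤ _ := h4
        _ = _ := by ring
    have h6 := (div_le_div_iff_of_pos_right hnR).1 h5
    linarith
  set W := V.filter (· ∉ A) with hW
  set P := W.image (comp G A) with hP
  set fib : Set X → Finset X := fun K => W.filter (comp G A · = K) with hfib
  have hcomp : ∀ x ∈ W, (fib (comp G A x) : Set X) = comp G A x := fun x hx => by
    obtain ⟨hxV, hxA⟩ := Finset.mem_filter.1 hx
    ext y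
    simp only [hfib, hW, Finset.coe_filter, Finset.mem_filter, Set.mem_ofPred_eq]
    constructor
    · rintro ⟨⟨-, hyA⟩, hy⟩
      rw [← hy]
      exact self_mem_comp hyA
    · intro hy
      exact ⟨⟨(hconn x hxV y).1 (reachable_of_mem_comp hy), notMem_of_mem_comp hy⟩,
        comp_eq_of_mem hy⟩
  have hcount : ∀ x ∈ W, (comp G A x).encard = (fib (comp G A x)).card := fun x hx => by
    rw [← Set.encard_coe_eq_coe_finsetCard, hcomp x hx]
  -- A vertex has at most |K| - 1 neighbors inside its component K, so at least d + 1 - |K| in `A`;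
  -- and |K|(d + 1 - |K|) - d = (|K| - 1)(d - |K|) ≥ 0.
  have hlocal : ∀ x ∈ W, (fib (comp G A x)).card ≤ d →
      d ≤ ∑ y ∈ fib (comp G A x), c A y := by
    intro x hx hk
    set K := fib (comp G A x) with hK
    have h1 : ∀ y ∈ K, d + 1 ≤ c A y + K.card := by
      intro y hy
      obtain ⟨hyW, hyx⟩ := Finset.mem_filter.1 hy
      obtain ⟨hyV, hyA⟩ := Finset.mem_filter.1 hyW
      have h2 : c A y + (Finset.univ.filter fun i => s i y ∉ A).card = d := by
        simpa using Finset.card_filter_add_card_filter_not (s := (Finset.univ : Finset (Fin d)))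
          (fun i => s i y ∈ A)
      have h3 : (Finset.univ.filter fun i => s i y ∉ A).card ≤ (K.erase y).card := by
        refine Finset.card_le_card_of_injOn (fun i => s i y) (fun i hi => ?_)
          (h.injective y (hVB hyV)).injOn
        have hiA : s i y ∉ A := by simpa using hi
        have hadj := h.adj (hVB hyV) i
        refine Finset.mem_coe.2 (Finset.mem_erase.2 ⟨hadj.ne', ?_⟩)
        rw [← Finset.mem_coe, hK, hcomp x hx, ← hyx]
        exact mem_comp_of_adj hyA hiA hadj
      rw [Finset.card_erase_of_mem hy] at h3
      have : 0 < K.card := Finset.card_pos.2 ⟨y, hy⟩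
      omega
    have hKpos : 0 < K.card := Finset.card_pos.2 ⟨x, Finset.mem_filter.2 ⟨hx, rfl⟩⟩
    have h2 : K.card * (d + 1 - K.card) ≤ ∑ y ∈ K, c A y := by
      rw [← smul_eq_mul]
      exact Finset.card_nsmul_le_sum _ _ _ fun y hy => by have := h1 y hy; omega
    refine le_trans ?_ h2
    obtain ⟨a, ha⟩ := Nat.exists_eq_add_of_le hk
    obtain ⟨b, hb⟩ := Nat.exists_eq_add_of_le hKpos
    have : d + 1 - K.card = a + 1 := by omega
    rw [this, ha, hb]
    nlinarith [Nat.zero_le (a * b)]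
  -- With |K| ≤ n/2, `hiso` gives at least (d+1)|K|/4 edges into `A`; then |K| ≥ d + 1 and (d+1)² ≥
  -- 4d suffice.
  have hspread : ∀ x ∈ W, d < (fib (comp G A x)).card → 2 * (fib (comp G A x)).card ≤ n →
      d ≤ ∑ y ∈ fib (comp G A x), c A y := by
    intro x hx hk hkn
    obtain ⟨hxV, hxA⟩ := Finset.mem_filter.1 hx
    set K := fib (comp G A x) with hK
    have hKV : K ⊆ V := (Finset.filter_subset _ _).trans (Finset.filter_subset _ _)
    have hKm : MeasurableSet (K : Set X) := K.measurableSet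
    have hKcoe : ∀ S : Set X, S = K → V.filter (· ∈ S) = K := by
      rintro S rfl
      ext y
      simp only [Finset.mem_filter, Finset.mem_coe]
      exact ⟨fun hy => hy.2, fun hy => ⟨hKV hy, hy⟩⟩
    have h1 := hiso K hKm
    have h2 : (edgeMeasure μ s K (K : Set X)ᶜ).toReal ≤ (edgeMeasure μ s K A).toReal := by
      refine ENNReal.toReal_mono (edgeMeasure_ne_top _ _ _ _) (h.edgeMeasure_compl_le
        (fun y hy => hVB (hKV hy)) ?_ ?_)
      · rw [hcomp x hx]
        exact Set.disjoint_left.2 fun y hy => notMem_of_mem_comp hy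
      · rw [hcomp x hx]
        exact fun y hy => (comp_eq_of_mem hy).subset
    rw [hedge K A, hKcoe _ rfl] at h2
    rw [hμ, hKcoe _ rfl] at h1
    have hkR1 : (d : ℝ) + 1 ≤ K.card := by exact_mod_cast hk
    have hkn' : 2 * (K.card : ℝ) ≤ n := by exact_mod_cast hkn
    set k : ℝ := ((K.card : ℕ) : ℝ) with hkR
    set E : ℝ := ((∑ y ∈ K, c A y : ℕ) : ℝ) with hE
    have hd0 : (0 : ℝ) ≤ d := by positivity
    have h3 : (d + 1) * (k * (n - k)) ≤ 2 * E * n := by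
      have h4 := h1.trans (mul_le_mul_of_nonneg_left h2 zero_le_two)
      have h5 := mul_le_mul_of_nonneg_right h4 (sq_nonneg (n : ℝ))
      have e1 : (d + 1) * (k / n - (k / n) ^ 2) * (n : ℝ) ^ 2 = (d + 1) * (k * (n - k)) := by
        field_simp
      have e2 : 2 * (E / n) * (n : ℝ) ^ 2 = 2 * E * n := by field_simp
      rwa [e1, e2] at h5
    have h4 : (d + 1) * k * n ≤ 4 * E * n := by
      have : (d + 1) * (k * n) ≤ (d + 1) * (2 * (k * (n - k))) := by
        refine mul_le_mul_of_nonneg_left ?_ (by positivity)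
        nlinarith
      linarith
    have h5 : (d + 1) * k ≤ 4 * E := le_of_mul_le_mul_right h4 hnR
    have h6 : (d : ℝ) ≤ E := by nlinarith [sq_nonneg ((d : ℝ) - 1)]
    exact Nat.cast_le.1 h6
  set Po := P.filter fun K => Odd (fib K).card with hPo
  have hmaps : ∀ x ∈ W, comp G A x ∈ P := fun x hx => Finset.mem_image_of_mem _ hx
  have hsmall : ∀ K ∈ P, 2 * (fib K).card ≤ n → d ≤ ∑ y ∈ fib K, c A y := by
    intro K hK hKn
    obtain ⟨x, hx, rfl⟩ := Finset.mem_image.1 hK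
    rcases le_or_gt (fib (comp G A x)).card d with h1 | h1
    · exact hlocal x hx h1
    · exact hspread x hx h1 hKn
  have hbig : (Po.filter fun K => ¬ 2 * (fib K).card ≤ n).card ≤ 1 := by
    refine Finset.card_le_one.2 fun K hK K' hK' => ?_
    by_contra hne
    have hdisj : Disjoint (fib K) (fib K') := Finset.disjoint_left.2 fun x hx hx' =>
      hne ((Finset.mem_filter.1 hx).2.symm.trans (Finset.mem_filter.1 hx').2)
    have hle : (fib K ∪ fib K').card ≤ n := Finset.card_le_card
      (Finset.union_subset ((Finset.filter_subset _ _).trans (Finset.filter_subset _ _))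
        ((Finset.filter_subset _ _).trans (Finset.filter_subset _ _)))
    rw [Finset.card_union_of_disjoint hdisj] at hle
    have h1 := (Finset.mem_filter.1 hK).2
    have h2 := (Finset.mem_filter.1 hK').2
    omega
  set a := (V.filter (· ∈ A)).card with ha
  have hedges : ∑ x ∈ W, c A x ≤ d * a := by
    have h1 := congrArg ENNReal.toReal (h.edgeMeasure_univ_left hpmp hA)
    rw [hedge, ENNReal.toReal_mul, ENNReal.toReal_natCast] at h1
    change _ = d * μ.real A at h1
    rw [hμ, ← mul_div_assoc, div_left_inj' hnR.ne'] at h1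
    have h2 : ∀ S : Set X, S = Set.univ → ∑ x ∈ V.filter (· ∈ S), c A x = d * a := by
      rintro S rfl
      rw [ha]
      exact_mod_cast h1
    rw [← h2 _ rfl]
    exact Finset.sum_le_sum_of_subset fun x hx => by
      simpa using (Finset.mem_filter.1 hx).1
  have hq1 : Po.card ≤ a + 1 := by
    have h1 : d * (Po.filter fun K => 2 * (fib K).card ≤ n).card ≤ d * a := by
      calc d * (Po.filter fun K => 2 * (fib K).card ≤ n).card
          ≤ ∑ K ∈ Po.filter (fun K => 2 * (fib K).card ≤ n), ∑ y ∈ fib K, c A y := by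
            rw [mul_comm, ← smul_eq_mul]
            refine Finset.card_nsmul_le_sum _ _ _ fun K hK => ?_
            obtain ⟨hK1, hK2⟩ := Finset.mem_filter.1 hK
            exact hsmall K (Finset.mem_filter.1 hK1).1 hK2
        _ ≤ ∑ K ∈ P, ∑ y ∈ fib K, c A y := Finset.sum_le_sum_of_subset
            ((Finset.filter_subset _ _).trans (Finset.filter_subset _ _))
        _ = ∑ x ∈ W, c A x := Finset.sum_fiberwise_of_maps_to hmaps _
        _ ≤ d * a := hedges
    have h2 := Nat.le_of_mul_le_mul_left h1 hd
    have h3 := Finset.card_filter_add_card_filter_not (s := Po) (fun K => 2 * (fib K).card ≤ n)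
    omega
  have hq : Po.card ≤ a := by
    have h1 : a + W.card = n := Finset.card_filter_add_card_filter_not _
    have h2 : W.card = ∑ K ∈ P, (fib K).card := Finset.card_eq_sum_card_fiberwise hmaps
    -- The number of vertices off `A` has the parity of the number of odd components; |A| + 1 odd
    -- components would make n odd.
    have h3 : Odd W.card ↔ Odd Po.card := by rw [h2, Finset.odd_sum_iff_odd_card_odd]
    by_contra hlt
    have h4 : Po.card = a + 1 := by omega
    rw [h4] at h3
    rw [← h1, Nat.even_add] at heven
    rw [← Nat.not_even_iff_odd, ← Nat.not_even_iff_odd, Nat.even_add_one] at h3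
    tauto
  have hnE : (n : ℝ≥0∞) ≠ 0 := by exact_mod_cast hn0.ne'
  have hμE : ∀ S, μ S = ((V.filter (· ∈ S)).card : ℝ≥0∞) / n := fun S => by
    rw [← ENNReal.toReal_eq_toReal_iff' (measure_ne_top _ _) (ENNReal.div_ne_top (by simp) hnE),
      ENNReal.toReal_div, ENNReal.toReal_natCast, ENNReal.toReal_natCast]
    exact hμ S
  -- Each odd component contributes exactly 1/n to ν: its size cancels the weight.
  have hterm : ∀ k : ℕ, μ (sizeSet G A (2 * k + 1)) / ((2 * k + 1 : ℕ) : ℝ≥0∞) =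
      ∑ K ∈ Po, if (fib K).card = 2 * k + 1 then (n : ℝ≥0∞)⁻¹ else 0 := by
    intro k
    have h1 : (V.filter (· ∈ sizeSet G A (2 * k + 1))).card =
        ∑ K ∈ Po.filter (fun K => (fib K).card = 2 * k + 1), (fib K).card := by
      rw [Finset.card_eq_sum_card_fiberwise (f := comp G A)
        (t := Po.filter (fun K => (fib K).card = 2 * k + 1))]
      · refine Finset.sum_congr rfl fun K hK => ?_
        congr 1
        ext x
        simp only [hfib, Finset.mem_filter, hW, mem_sizeSet]
        constructor
        · rintro ⟨⟨hxV, hxA, -⟩, hxK⟩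
          exact ⟨⟨hxV, hxA⟩, hxK⟩
        · rintro ⟨⟨hxV, hxA⟩, rfl⟩
          refine ⟨⟨hxV, hxA, ?_⟩, rfl⟩
          rw [hcount x (Finset.mem_filter.2 ⟨hxV, hxA⟩), (Finset.mem_filter.1 hK).2]
      · intro x hx
        obtain ⟨hxV, hx⟩ := Finset.mem_filter.1 hx
        obtain ⟨hxA, hxc⟩ := mem_sizeSet.1 hx
        have hxW : x ∈ W := Finset.mem_filter.2 ⟨hxV, hxA⟩
        rw [hcount x hxW] at hxc
        have hxc' : (fib (comp G A x)).card = 2 * k + 1 := by exact_mod_cast hxc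
        exact Finset.mem_filter.2 ⟨Finset.mem_filter.2 ⟨hmaps x hxW, hxc' ▸ odd_two_mul_add_one k⟩,
          hxc'⟩
    have hk0 : ((2 * k + 1 : ℕ) : ℝ≥0∞) ≠ 0 := Nat.cast_ne_zero.2 (2 * k).succ_ne_zero
    rw [hμE, h1, Finset.sum_congr rfl fun K hK => (Finset.mem_filter.1 hK).2, Finset.sum_const,
      ← Finset.sum_filter, Finset.sum_const, smul_eq_mul, nsmul_eq_mul, Nat.cast_mul,
      div_eq_mul_inv, div_eq_mul_inv, mul_right_comm, mul_assoc, mul_assoc,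
      ENNReal.mul_inv_cancel_left hk0 (ENNReal.natCast_ne_top _)]
  have htsum : ∀ K ∈ Po, ∑' k : ℕ, (if (fib K).card = 2 * k + 1 then (n : ℝ≥0∞)⁻¹ else 0) =
      (n : ℝ≥0∞)⁻¹ := by
    intro K hK
    obtain ⟨m, hm⟩ := (Finset.mem_filter.1 hK).2
    rw [tsum_eq_single m fun k hk => if_neg (by omega), if_pos hm]
  rw [nu_oddSet, tsum_congr hterm, Summable.tsum_finsetSum fun _ _ => ENNReal.summable,
    Finset.sum_congr rfl htsum, Finset.sum_const, nsmul_eq_mul, hμE A, div_eq_mul_inv,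
    ENNReal.coe_one, one_mul]
  gcongr

end Enumerates

end BorelGraph

end

theorem theorem7p6 {X : Type*} [MeasurableSpace X] [StandardBorelSpace X]
    (μ : Measure X) [IsProbabilityMeasure μ] (G : SimpleGraph X) (d : ℕ)
    (hBorel : BorelGraph.IsBorel G) (hpmp : BorelGraph.IsPMP G μ)
    (herg : BorelGraph.IsErgodic G μ) (hreg : BorelGraph.IsRegular G μ d)
    (hspec : BorelGraph.ML G μ ≤ 2 * BorelGraph.mL G μ) :
    ((∀ x, μ {x} = 0) → BorelGraph.StrictTutteCondition G μ) ∧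
    ((∃ x, μ {x} ≠ 0) → Even {x : X | μ {x} ≠ 0}.ncard →
      BorelGraph.TutteCondition G μ 1) := by
  obtain ⟨B, s, h⟩ := BorelGraph.exists_enumerates hBorel hpmp hreg
  exact ⟨h.strictTutteCondition_of_nonatomic hpmp herg hspec,
    fun ⟨_, hx⟩ => h.tutteCondition_of_atom hpmp herg hspec hx⟩
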